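/- **Proposition 3.2.** Let $d\in\{1,2,3\}$ and let $\Omega\subset\mathbb{R}^d$ be a bounded convex domain (such a domain automatically has Lipschitz boundary). There is a function $c=c(\delta_1,\delta_2,s)>0$, depending only on $d$ and $\Omega$, with the following property. Let $u\in H^2(\Omega)$ be such that $k\le u\le k^{-1}$ a.e. in $\Omega$ for some $k\in(0,1)$. Then $\log u$ is weakly differentiable, the functions $u^4$, $u^2|\nabla\log u|^4$ and $|\nabla u|^2$ are integrable on $\Omega$, and for all $\delta_1,\delta_2>0$ $$\int_\Omega u^4\,dx\;\le\;\delta_1\int_\Omega u^2\,|\nabla\log u|^4\,dx+\delta_2\int_\Omega|\nabla u|^2\,dx+c\big(\delta_1,\delta_2,\|u\|_{L^2(\Omega)}\big).$$ In particular the last term does not depend on $k$, and depends on $u$ only through $\|u\|_{L^2(\Omega)}$. -/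

import Mathlib

open MeasureTheory
open scoped ContDiff

/-- `g` is a weak `i`-th partial derivative of `u` on the open set `Ω`: both functions are in
`L¹_loc(Ω)` and `∫_Ω u ∂ᵢφ = -∫_Ω g φ` for every test function `φ ∈ C_c^∞(Ω)`. -/
def HasWeakPartialDeriv {d : ℕ} (Ω : Set (EuclideanSpace ℝ (Fin d)))
    (u : EuclideanSpace ℝ (Fin d) → ℝ) (i : Fin d) (g : EuclideanSpace ℝ (Fin d) → ℝ) : Prop :=
  LocallyIntegrableOn u Ω volume ∧ LocallyIntegrableOn g Ω volume ∧
    ∀ φ : EuclideanSpace ℝ (Fin d) → ℝ, ContDiff ℝ ∞ φ → HasCompactSupport φ → tsupport φ ⊆ Ω →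
      ∫ x in Ω, u x * fderiv ℝ φ x (EuclideanSpace.single i 1) = -∫ x in Ω, g x * φ x

/-- The vector field `g` is a weak gradient of `u` on `Ω`. -/
def HasWeakGradient {d : ℕ} (Ω : Set (EuclideanSpace ℝ (Fin d)))
    (u : EuclideanSpace ℝ (Fin d) → ℝ)
    (g : EuclideanSpace ℝ (Fin d) → EuclideanSpace ℝ (Fin d)) : Prop :=
  ∀ i : Fin d, HasWeakPartialDeriv Ω u i (fun x => g x i)

/-- The Sobolev space `H²(Ω) = W^{2,2}(Ω)`: `u` and its weak partial derivatives of order one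
and two belong to `L²(Ω)`. -/
def MemH2 {d : ℕ} (Ω : Set (EuclideanSpace ℝ (Fin d)))
    (u : EuclideanSpace ℝ (Fin d) → ℝ) : Prop :=
  MemLp u 2 (volume.restrict Ω) ∧
    ∃ g : EuclideanSpace ℝ (Fin d) → EuclideanSpace ℝ (Fin d),
      HasWeakGradient Ω u g ∧ MemLp g 2 (volume.restrict Ω) ∧
        ∀ i : Fin d, ∃ h : EuclideanSpace ℝ (Fin d) → EuclideanSpace ℝ (Fin d),
          HasWeakGradient Ω (fun x => g x i) h ∧ MemLp h 2 (volume.restrict Ω)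

/-! Put v = √u. Then ∇v = ½ √u ∇log u, so 16|∇v|⁴ = u²|∇log u|⁴, while the integral of v⁴ is ‖u‖² in
L². For d ≤ 3 the exponent 4 exceeds the dimension, so Morrey's inequality bounds v⁴ = u² almost
everywhere. With a free scale t in (0,1] it reads u² ≤ C(t⁻³‖u‖² + t ∫u²|∇log u|⁴), by
`exists_morrey_const` applied to v. Multiplying by u² and integrating gives
`exists_interpolation_const`. Choosing t with C‖u‖²t ≤ δ₁ proves the claim, the t⁻³ term becoming
the constant c; the δ₂ term is nonnegative and is simply added.

The bounds by k and k⁻¹ enter only qualitatively: they make √ and log admissible in the chain rule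
`HasWeakGradient.comp` and make the integrals finite. Integrability of u²|∇log u|⁴ requires ∇u in
L⁴, which is the Sobolev embedding `HasWeakGradient.lintegral_pow_four_lt_top` applied to each first
derivative of u.

Both embeddings come from one estimate, `SegmentBound.pow_four_le`: the fundamental theorem of
calculus along segments from x towards the points y of a fixed ball in Ω, averaged over y. Convexity
keeps the segments in Ω. The estimate is applied to mollifications at points away from the boundary,
with constants independent of the mollification scale, and then passed to the limit. -/

/-! ### Averages along segments: Morrey and Sobolev inequalities -/

section SegmentAverage

/-- A power form of Jensen's inequality for the Lebesgue integral on a probability space. -/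
theorem lintegral_pow_le_lintegral_pow {α : Type*} [MeasurableSpace α] {μ : Measure α}
    [IsProbabilityMeasure μ] {f : α → ENNReal} (hf : AEMeasurable f μ) {n : ℕ} (hn : n ≠ 0) :
    (∫⁻ x, f x ∂μ) ^ n ≤ ∫⁻ x, f x ^ n ∂μ := by
  have h := eLpNorm'_le_eLpNorm'_of_exponent_le (μ := μ) (f := f) (p := 1) (q := n) one_pos
    (by exact_mod_cast Nat.one_le_iff_ne_zero.2 hn) hf.aestronglyMeasurable
  have h2 := pow_le_pow_left' h n
  simp only [eLpNorm', enorm_eq_self, ENNReal.rpow_one, div_one] at h2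
  rw [← ENNReal.rpow_natCast (_ ^ (1 / (n : ℝ))), ← ENNReal.rpow_mul, one_div,
    inv_mul_cancel₀ (by exact_mod_cast hn), ENNReal.rpow_one] at h2
  simpa using h2

theorem ENNReal.add_pow_four_le (a b : ENNReal) : (a + b) ^ 4 ≤ 8 * (a ^ 4 + b ^ 4) := by
  have h := ENNReal.rpow_add_le_mul_rpow_add_rpow a b (p := 4) (by norm_num)
  have h2 : (2 : ENNReal) ^ ((4 : ℝ) - 1) = 8 := by
    rw [show ((4 : ℝ) - 1) = ((3 : ℕ) : ℝ) by norm_num, ENNReal.rpow_natCast]; norm_num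
  rw [h2] at h
  exact_mod_cast h

variable {E : Type*} [NormedAddCommGroup E] [InnerProductSpace ℝ E] [FiniteDimensional ℝ E]
  [MeasurableSpace E] [BorelSpace E]

theorem lintegral_comp_add_smul {f : E → ENNReal} (hf : Measurable f) (c : E) {s : ℝ}
    (hs : 0 < s) :
    ∫⁻ y, f (c + s • y) = ENNReal.ofReal ((s ^ Module.finrank ℝ E)⁻¹) * ∫⁻ y, f y := by
  have h1 : ∫⁻ y, f (c + s • y) = ∫⁻ z, f (c + z) ∂(Measure.map (fun y => s • y) volume) := by
    rw [lintegral_map (by fun_prop) (by fun_prop)]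
  rw [h1, Measure.map_addHaar_smul _ hs.ne', lintegral_smul_measure,
    lintegral_add_left_eq_self f c, abs_of_pos (by positivity), smul_eq_mul]

/-- The average of `f` over the homothetic image, with centre `x` and ratio `s`, of the
measure `ν`. -/
noncomputable def segmentAverage (ν : Measure E) (f : E → ENNReal) (s : ℝ) (x : E) : ENNReal :=
  ∫⁻ y, f (x + s • (y - x)) ∂ν

variable {ν : Measure E} {b : ENNReal}

/-- For fixed x the map in y is a homothety of ratio s, and ν has density at most b. The bound is
uniform in x but singular as s tends to 0. -/
theorem segmentAverage_le (hν : ν ≤ b • volume) {f : E → ENNReal} (hf : Measurable f) {s : ℝ}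
    (hs : 0 < s) (x : E) :
    segmentAverage ν f s x
      ≤ b * (ENNReal.ofReal ((s ^ Module.finrank ℝ E)⁻¹) * ∫⁻ y, f y) := by
  calc segmentAverage ν f s x ≤ ∫⁻ y, f (x + s • (y - x)) ∂(b • volume) :=
        lintegral_mono' hν le_rfl
    _ = b * ∫⁻ y, f ((x - s • x) + s • y) := by
        rw [lintegral_smul_measure, smul_eq_mul]
        congr 2; ext y; congr 1; rw [smul_sub]; abel
    _ = _ := by rw [lintegral_comp_add_smul hf _ hs]

theorem segmentAverage_pow_le [IsProbabilityMeasure ν] {f : E → ENNReal} (hf : Measurable f)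
    (s : ℝ) (x : E) {n : ℕ} (hn : n ≠ 0) :
    segmentAverage ν f s x ^ n ≤ segmentAverage ν (fun y => f y ^ n) s x :=
  lintegral_pow_le_lintegral_pow (by fun_prop) hn

/-- Integrating in x first, for fixed y, gives a homothety of ratio 1 - s. Unlike the pointwise
bound, this stays bounded as s tends to 0. -/
theorem lintegral_segmentAverage [IsProbabilityMeasure ν] {f : E → ENNReal} (hf : Measurable f)
    {s : ℝ} (hs : s < 1) :
    ∫⁻ x, segmentAverage ν f s x
      = ENNReal.ofReal (((1 - s) ^ Module.finrank ℝ E)⁻¹) * ∫⁻ y, f y := by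
  unfold segmentAverage
  rw [lintegral_lintegral_swap (by fun_prop)]
  have : ∀ y : E, ∫⁻ x, f (x + s • (y - x))
      = ENNReal.ofReal (((1 - s) ^ Module.finrank ℝ E)⁻¹) * ∫⁻ y, f y := fun y => by
    rw [← lintegral_comp_add_smul hf (s • y) (sub_pos.2 hs)]
    congr 1; ext x; congr 1; rw [smul_sub, sub_smul, one_smul]; abel
  simp [this]

theorem measurable_segmentAverage [SFinite ν] {f : E → ENNReal} (hf : Measurable f) :
    Measurable fun p : E × ℝ => segmentAverage ν f p.2 p.1 := by
  unfold segmentAverage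
  refine Measurable.lintegral_prod_right' (f := fun q : (E × ℝ) × E =>
    f (q.1.1 + q.1.2 • (q.2 - q.1.1))) ?_
  fun_prop

/-- `SegmentBound B D V G t x` says that `V x` is controlled by the value of `V` at distance `t`
along each segment from `x` to a point of `B`, plus the integral of `D * G` on the way, the way
being run through with parameter `t τ ^ 4`. -/
def SegmentBound (B : Set E) (D : ENNReal) (V G : E → ENNReal) (t : ℝ) (x : E) : Prop :=
  ∀ y ∈ B, V x ≤ V (x + t • (y - x)) +
    ∫⁻ τ in Set.Icc (0 : ℝ) 1, ENNReal.ofReal (4 * t * τ ^ 3) * D * G (x + (t * τ ^ 4) • (y - x))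

variable {B : Set E} {D : ENNReal} {V G : E → ENNReal} {t : ℝ} {x : E}

instance : IsProbabilityMeasure ((volume : Measure ℝ).restrict (Set.Icc 0 1)) :=
  ⟨by simp⟩

theorem SegmentBound.pow_four_le [IsProbabilityMeasure ν] (hB : ∀ᵐ y ∂ν, y ∈ B)
    (hV : Measurable V) (hG : Measurable G) (h : SegmentBound B D V G t x) :
    V x ^ 4 ≤ 8 * (segmentAverage ν V t x ^ 4 +
      ∫⁻ τ in Set.Icc (0 : ℝ) 1,
        (ENNReal.ofReal (4 * t * τ ^ 3) * D) ^ 4 * segmentAverage ν G (t * τ ^ 4) x ^ 4) := by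
  have h1 : V x ≤ segmentAverage ν V t x + ∫⁻ τ in Set.Icc (0 : ℝ) 1,
      ENNReal.ofReal (4 * t * τ ^ 3) * D * segmentAverage ν G (t * τ ^ 4) x := by
    calc V x = ∫⁻ _, V x ∂ν := by simp
      _ ≤ ∫⁻ y, (V (x + t • (y - x)) + ∫⁻ τ in Set.Icc (0 : ℝ) 1,
            ENNReal.ofReal (4 * t * τ ^ 3) * D * G (x + (t * τ ^ 4) • (y - x))) ∂ν :=
          lintegral_mono_ae (hB.mono h)
      _ = _ := by
          rw [lintegral_add_left (by fun_prop), lintegral_lintegral_swap (by fun_prop)]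
          congr 1
          refine lintegral_congr fun τ => ?_
          rw [lintegral_const_mul _ (by fun_prop), segmentAverage]
  refine (pow_le_pow_left' h1 4).trans ((ENNReal.add_pow_four_le _ _).trans ?_)
  gcongr
  refine (lintegral_pow_le_lintegral_pow ?_ four_ne_zero).trans ?_
  · refine Measurable.aemeasurable ?_
    refine Measurable.mul (by fun_prop) ?_
    exact (measurable_segmentAverage hG).comp (f := fun τ : ℝ => (x, t * τ ^ 4)) (by fun_prop)
  · simp_rw [mul_pow]; exact le_rfl

/-- This is the reason for the parameter t τ⁴: the speed 4tτ³ to the fourth power is 256 t⁴τ¹², and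
the Jacobian (tτ⁴)⁻³ cancels τ¹² exactly, leaving 256 t. Lower dimensions have a smaller Jacobian
because tτ⁴ ≤ 1. -/
theorem weight_pow_four_mul_le (hE : Module.finrank ℝ E ≤ 3) (ht : 0 < t) (ht1 : t ≤ 1) {τ : ℝ}
    (hτ : 0 < τ) (hτ1 : τ ≤ 1) :
    (ENNReal.ofReal (4 * t * τ ^ 3) * D) ^ 4 *
        ENNReal.ofReal (((t * τ ^ 4) ^ Module.finrank ℝ E)⁻¹)
      ≤ D ^ 4 * ENNReal.ofReal (256 * t) := by
  rw [mul_pow, ← ENNReal.ofReal_pow (by positivity), mul_right_comm,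
    ← ENNReal.ofReal_mul (by positivity), mul_comm]
  refine mul_le_mul_right (ENNReal.ofReal_le_ofReal ?_) _
  have h0 : 0 < t * τ ^ 4 := by positivity
  have h1 : (t * τ ^ 4) ^ 3 ≤ (t * τ ^ 4) ^ Module.finrank ℝ E :=
    pow_le_pow_of_le_one h0.le (mul_le_one₀ ht1 (by positivity) (pow_le_one₀ hτ.le hτ1)) hE
  calc (4 * t * τ ^ 3) ^ 4 * ((t * τ ^ 4) ^ Module.finrank ℝ E)⁻¹
      ≤ (4 * t * τ ^ 3) ^ 4 * ((t * τ ^ 4) ^ 3)⁻¹ := by gcongr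
    _ = 256 * t := by field_simp; norm_num

/-- Morrey's inequality in dimension at most three, from a bound along segments. -/
theorem SegmentBound.morrey [IsProbabilityMeasure ν] (hν : ν ≤ b • volume)
    (hE : Module.finrank ℝ E ≤ 3) (hB : ∀ᵐ y ∂ν, y ∈ B)
    (hV : Measurable V) (hG : Measurable G) (ht : 0 < t) (ht1 : t ≤ 1)
    (h : SegmentBound B D V G t x) :
    V x ^ 4 ≤ 8 * (b * ENNReal.ofReal ((t ^ 3)⁻¹) * ∫⁻ y, V y ^ 4) +
      8 * (D ^ 4 * ENNReal.ofReal (256 * t) * (b * ∫⁻ y, G y ^ 4)) := by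
  refine (h.pow_four_le hB hV hG).trans ?_
  rw [mul_add]
  gcongr
  · refine (segmentAverage_pow_le hV t x four_ne_zero).trans
      ((segmentAverage_le hν (by fun_prop) ht x).trans ?_)
    rw [mul_assoc]
    refine mul_le_mul_right (mul_le_mul_left (ENNReal.ofReal_le_ofReal ?_) _) _
    exact inv_anti₀ (by positivity) (pow_le_pow_of_le_one ht.le ht1 hE)
  · calc _ ≤ ∫⁻ τ in Set.Icc (0 : ℝ) 1,
        D ^ 4 * ENNReal.ofReal (256 * t) * (b * ∫⁻ y, G y ^ 4) := by
          refine setLIntegral_mono' measurableSet_Icc fun τ hτ => ?_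
          -- At τ = 0 the homothety degenerates, but the weight τ³ vanishes.
          rcases hτ.1.eq_or_lt with rfl | h0
          · simp
          refine (mul_le_mul_right ((segmentAverage_pow_le hG _ x four_ne_zero).trans
            (segmentAverage_le hν (by fun_prop) (by positivity) x)) _).trans ?_
          rw [mul_left_comm b, ← mul_assoc]
          exact mul_le_mul_left (weight_pow_four_mul_le hE ht ht1 h0 hτ.2) _
      _ = _ := by simp

/-- The Sobolev inequality for `L²` gradients and the exponent four in dimension at most three,
from a bound along segments. -/
theorem SegmentBound.sobolev [IsProbabilityMeasure ν] (hν : ν ≤ b • volume)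
    (hE : Module.finrank ℝ E ≤ 3) (hB : ∀ᵐ y ∂ν, y ∈ B)
    (hV : Measurable V) (hG : Measurable G) {S : Set E} (hS : MeasurableSet S)
    (h : ∀ x ∈ S, SegmentBound B D V G (1 / 2) x) :
    ∫⁻ x in S, V x ^ 4 ≤ 8 * ((b * (8 * ∫⁻ y, V y)) ^ 4 * volume S +
      D ^ 4 * 128 * (8 * b) * (∫⁻ y, G y ^ 2) ^ 2) := by
  have half : ENNReal.ofReal (((1 / 2 : ℝ) ^ Module.finrank ℝ E)⁻¹) ≤ 8 := by
    rw [show (8 : ENNReal) = ENNReal.ofReal 8 by simp]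
    refine ENNReal.ofReal_le_ofReal ?_
    rw [← inv_pow]
    exact (pow_le_pow_right₀ (by norm_num) hE).trans (by norm_num)
  have mA (s : ℝ) : Measurable fun x => segmentAverage ν G s x :=
    (measurable_segmentAverage hG).comp (f := fun x : E => (x, s)) (by fun_prop)
  have mA2 : Measurable fun p : E × ℝ => segmentAverage ν G (1 / 2 * p.2 ^ 4) p.1 :=
    (measurable_segmentAverage hG).comp (f := fun p : E × ℝ => (p.1, 1 / 2 * p.2 ^ 4))
      (by fun_prop)
  have key (τ : ℝ) (hτ : τ ∈ Set.Icc (0 : ℝ) 1) :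
      ∫⁻ x, (ENNReal.ofReal (4 * (1 / 2) * τ ^ 3) * D) ^ 4 *
        segmentAverage ν G (1 / 2 * τ ^ 4) x ^ 4
        ≤ D ^ 4 * 128 * (8 * b) * (∫⁻ y, G y ^ 2) ^ 2 := by
    rcases hτ.1.eq_or_lt with rfl | h0
    · simp
    set s : ℝ := 1 / 2 * τ ^ 4 with hs
    have hs0 : 0 < s := by positivity
    have hs1 : s ≤ 1 / 2 := by
      have : τ ^ 4 ≤ 1 := pow_le_one₀ h0.le hτ.2
      rw [hs]; linarith
    set N := ∫⁻ y, G y ^ 2 with hN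
    set σ := ENNReal.ofReal ((s ^ Module.finrank ℝ E)⁻¹) with hσ
    rw [lintegral_const_mul _ ((mA s).pow_const 4)]
    -- Only G² is integrable here, so the fourth power is split into two squares: one is bounded
    -- uniformly in x, at the cost of σ, and the other is integrated in x, at the cost of at most 2ᵈ
    -- ≤ 8 since s ≤ 1/2.
    have h1 : ∫⁻ x, segmentAverage ν G s x ^ 4 ≤ σ * (b * N * (8 * N)) := by
      calc ∫⁻ x, segmentAverage ν G s x ^ 4
          ≤ ∫⁻ x, (b * (σ * N)) * segmentAverage ν (fun y => G y ^ 2) s x := by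
            refine lintegral_mono fun x => ?_
            have e1 := segmentAverage_pow_le (ν := ν) hG s x two_ne_zero
            calc segmentAverage ν G s x ^ 4
                = segmentAverage ν G s x ^ 2 * segmentAverage ν G s x ^ 2 := by ring
              _ ≤ _ := mul_le_mul' (e1.trans (segmentAverage_le hν (by fun_prop) hs0 x)) e1
        _ = b * (σ * N) * (ENNReal.ofReal (((1 - s) ^ Module.finrank ℝ E)⁻¹) * N) := by
            have m2 : Measurable fun x => segmentAverage ν (fun y => G y ^ 2) s x :=
              (measurable_segmentAverage (hG.pow_const 2)).comp
                (f := fun x : E => (x, s)) (by fun_prop)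
            rw [lintegral_const_mul _ m2,
              lintegral_segmentAverage (hG.pow_const 2) (by linarith)]
        _ ≤ b * (σ * N) * (8 * N) := by
            gcongr
            refine le_trans (ENNReal.ofReal_le_ofReal ?_) half
            gcongr
            linarith
        _ = _ := by ring
    calc _ ≤ (ENNReal.ofReal (4 * (1 / 2) * τ ^ 3) * D) ^ 4 * (σ * (b * N * (8 * N))) := by gcongr
      _ = ((ENNReal.ofReal (4 * (1 / 2) * τ ^ 3) * D) ^ 4 * σ) * (b * N * (8 * N)) := by ring
      _ ≤ (D ^ 4 * ENNReal.ofReal (256 * (1 / 2))) * (b * N * (8 * N)) := by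
          exact mul_le_mul_left
            (weight_pow_four_mul_le hE (by norm_num) (by norm_num) h0 hτ.2) _
      _ = _ := by
          rw [show ENNReal.ofReal (256 * (1 / 2)) = 128 by norm_num]
          ring
  calc ∫⁻ x in S, V x ^ 4
      ≤ ∫⁻ x in S, 8 * ((b * (8 * ∫⁻ y, V y)) ^ 4 + ∫⁻ τ in Set.Icc (0 : ℝ) 1,
          (ENNReal.ofReal (4 * (1 / 2) * τ ^ 3) * D) ^ 4 *
            segmentAverage ν G (1 / 2 * τ ^ 4) x ^ 4) := by
        refine setLIntegral_mono' hS fun x hx => ((h x hx).pow_four_le hB hV hG).trans ?_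
        gcongr
        refine (segmentAverage_le hν hV (by norm_num) x).trans ?_
        gcongr
    _ = 8 * ((b * (8 * ∫⁻ y, V y)) ^ 4 * volume S + ∫⁻ x in S, ∫⁻ τ in Set.Icc (0 : ℝ) 1,
          (ENNReal.ofReal (4 * (1 / 2) * τ ^ 3) * D) ^ 4 *
            segmentAverage ν G (1 / 2 * τ ^ 4) x ^ 4) := by
        rw [lintegral_const_mul' _ _ (by norm_num), lintegral_add_left measurable_const]
        simp
    _ ≤ _ := by
        gcongr
        rw [lintegral_lintegral_swap]
        · calc _ ≤ ∫⁻ τ in Set.Icc (0 : ℝ) 1,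
              D ^ 4 * 128 * (8 * b) * (∫⁻ y, G y ^ 2) ^ 2 := by
                refine setLIntegral_mono' measurableSet_Icc fun τ hτ =>
                  (setLIntegral_le_lintegral _ _).trans (key τ hτ)
            _ = _ := by simp
        · refine Measurable.aemeasurable ?_
          exact Measurable.mul (by fun_prop) (mA2.pow_const 4)

end SegmentAverage

/-! ### Mollification and its convergence -/

section Mollification

open Filter Topology Convolution

/-- Almost everywhere convergence without loss of mass implies convergence in `L¹`. -/
theorem tendsto_lintegral_enorm_sub_of_lintegral_le {α F : Type*} [MeasurableSpace α]
    {μ : Measure α} [NormedAddCommGroup F] {f : ℕ → α → F} {g : α → F}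
    (hf : ∀ n, AEStronglyMeasurable (f n) μ) (hg : AEStronglyMeasurable g μ)
    (hle : ∀ n, ∫⁻ x, ‖f n x‖ₑ ∂μ ≤ ∫⁻ x, ‖g x‖ₑ ∂μ) (hfin : ∫⁻ x, ‖g x‖ₑ ∂μ ≠ ⊤)
    (hlim : ∀ᵐ x ∂μ, Tendsto (fun n => f n x) atTop (𝓝 (g x))) :
    Tendsto (fun n => ∫⁻ x, ‖f n x - g x‖ₑ ∂μ) atTop (𝓝 0) := by
  set I := ∫⁻ x, ‖g x‖ₑ ∂μ with hI
  have htri (n : ℕ) (x : α) : ‖f n x - g x‖ₑ ≤ ‖f n x‖ₑ + ‖g x‖ₑ := enorm_sub_le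
  have hmeas (n : ℕ) : AEMeasurable (fun x => ‖f n x - g x‖ₑ) μ := ((hf n).sub hg).enorm
  have hsum (n : ℕ) : ∫⁻ x, (‖f n x‖ₑ + ‖g x‖ₑ - ‖f n x - g x‖ₑ) ∂μ
      + ∫⁻ x, ‖f n x - g x‖ₑ ∂μ ≤ I + I := by
    rw [← lintegral_add_right' _ (hmeas n)]
    calc _ = ∫⁻ x, (‖f n x‖ₑ + ‖g x‖ₑ) ∂μ :=
          lintegral_congr fun x => tsub_add_cancel_of_le (htri n x)
      _ = ∫⁻ x, ‖f n x‖ₑ ∂μ + I := lintegral_add_left' (hf n).enorm _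
      _ ≤ _ := by gcongr; exact hle n
  -- Fatou's lemma for the nonnegative functions |fₙ| + |g| - |fₙ - g|, which converge almost
  -- everywhere to 2|g|.
  have hfatou : I + I ≤ liminf (fun n => ∫⁻ x, (‖f n x‖ₑ + ‖g x‖ₑ - ‖f n x - g x‖ₑ) ∂μ) atTop := by
    refine le_trans (le_of_eq ?_) (lintegral_liminf_le' fun n =>
      (((hf n).enorm.add hg.enorm).sub (hmeas n)))
    rw [hI, ← lintegral_add_left' hg.enorm]
    refine lintegral_congr_ae (hlim.mono fun x hx => ?_)
    have h1 : Tendsto (fun n => ‖f n x‖ₑ + ‖g x‖ₑ - ‖f n x - g x‖ₑ) atTop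
        (𝓝 (‖g x‖ₑ + ‖g x‖ₑ - ‖g x - g x‖ₑ)) :=
      ENNReal.Tendsto.sub ((continuous_enorm.continuousAt.tendsto.comp hx).add tendsto_const_nhds)
        (continuous_enorm.continuousAt.tendsto.comp (hx.sub tendsto_const_nhds))
        (Or.inl (by finiteness))
    simpa using h1.liminf_eq.symm
  refine ENNReal.tendsto_nhds_zero.2 fun ε hε => ?_
  rcases eq_or_ne (I + I) 0 with h0 | h0
  · refine Eventually.of_forall fun n => ?_
    have := hsum n
    rw [h0] at this
    exact (le_add_self.trans this).trans (by simp)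
  · have hII : I + I ≠ ⊤ := by finiteness
    have hlt : I + I - ε < liminf (fun n => ∫⁻ x, (‖f n x‖ₑ + ‖g x‖ₑ - ‖f n x - g x‖ₑ) ∂μ) atTop :=
      (ENNReal.sub_lt_self hII h0 hε.ne').trans_le hfatou
    filter_upwards [eventually_lt_of_lt_liminf hlt] with n hn
    have h2 : I + I ≤ ∫⁻ x, (‖f n x‖ₑ + ‖g x‖ₑ - ‖f n x - g x‖ₑ) ∂μ + ε :=
      tsub_le_iff_right.1 hn.le
    have h3 : ∫⁻ x, (‖f n x‖ₑ + ‖g x‖ₑ - ‖f n x - g x‖ₑ) ∂μ ≠ ⊤ :=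
      ne_top_of_le_ne_top hII (le_self_add.trans (hsum n))
    exact (ENNReal.add_le_add_iff_left h3).1 ((hsum n).trans h2)

variable {E : Type*} [NormedAddCommGroup E] [InnerProductSpace ℝ E] [FiniteDimensional ℝ E]
  [MeasurableSpace E] [BorelSpace E]
variable {F : Type*} [NormedAddCommGroup F] [NormedSpace ℝ F]

/-- A bump function supported in the ball of radius `1 / (n + 1)`. -/
noncomputable def mollifierBump (E : Type*) [NormedAddCommGroup E] (n : ℕ) :
    ContDiffBump (0 : E) where
  rIn := 1 / (n + 1) / 2
  rOut := 1 / (n + 1)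
  rIn_pos := by positivity
  rIn_lt_rOut := half_lt_self (by positivity)

/-- The standard mollifier with support in the ball of radius `1 / (n + 1)`. -/
noncomputable def mollifier (E : Type*) [NormedAddCommGroup E] [InnerProductSpace ℝ E]
    [FiniteDimensional ℝ E] [MeasurableSpace E] [BorelSpace E] (n : ℕ) : E → ℝ :=
  (mollifierBump E n).normed volume

/-- The mollification of `f` at scale `1 / (n + 1)`. -/
noncomputable def mollify (n : ℕ) (f : E → F) : E → F :=
  mollifier E n ⋆[ContinuousLinearMap.lsmul ℝ ℝ, volume] f

theorem mollifier_nonneg (n : ℕ) (x : E) : 0 ≤ mollifier E n x :=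
  (mollifierBump E n).nonneg_normed x

theorem contDiff_mollifier (n : ℕ) : ContDiff ℝ ∞ (mollifier E n) :=
  (mollifierBump E n).contDiff_normed (n := ⊤)

theorem hasCompactSupport_mollifier (n : ℕ) : HasCompactSupport (mollifier E n) :=
  (mollifierBump E n).hasCompactSupport_normed

theorem integral_mollifier (n : ℕ) : ∫ x, mollifier E n x = 1 :=
  (mollifierBump E n).integral_normed

theorem integrable_mollifier (n : ℕ) : Integrable (mollifier E n) :=
  (mollifierBump E n).integrable_normed

theorem tsupport_mollifier (n : ℕ) :
    tsupport (mollifier E n) = Metric.closedBall 0 (1 / (n + 1)) :=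
  (mollifierBump E n).tsupport_normed_eq

theorem mollify_apply (n : ℕ) (f : E → F) (x : E) :
    mollify n f x = ∫ t, mollifier E n t • f (x - t) := rfl

theorem ae_tendsto_mollify [CompleteSpace F] {f : E → F} (hf : LocallyIntegrable f) :
    ∀ᵐ x, Tendsto (fun n => mollify n f x) atTop (𝓝 (f x)) := by
  refine ContDiffBump.ae_convolution_tendsto_right_of_locallyIntegrable (K := 2)
    (φ := mollifierBump E) tendsto_one_div_add_atTop_nhds_zero_nat
    (Eventually.of_forall fun n => ?_) hf
  change (1 : ℝ) / (n + 1) ≤ 2 * (1 / (n + 1) / 2)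
  linarith

theorem contDiff_mollify [CompleteSpace F] {f : E → F} (hf : LocallyIntegrable f) (n : ℕ) :
    ContDiff ℝ ∞ (mollify n f) :=
  (hasCompactSupport_mollifier n).contDiff_convolution_left (n := ⊤) _ (contDiff_mollifier n) hf

/-- The probability measure with density the mollifier. -/
noncomputable def mollifierMeasure (E : Type*) [NormedAddCommGroup E] [InnerProductSpace ℝ E]
    [FiniteDimensional ℝ E] [MeasurableSpace E] [BorelSpace E] (n : ℕ) : Measure E :=
  volume.withDensity fun x => ENNReal.ofReal (mollifier E n x)

instance (n : ℕ) : IsProbabilityMeasure (mollifierMeasure E n) := by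
  refine ⟨?_⟩
  rw [mollifierMeasure, withDensity_apply _ MeasurableSet.univ, setLIntegral_univ,
    ← ofReal_integral_eq_lintegral_ofReal (integrable_mollifier n)
      (ae_of_all _ (mollifier_nonneg n)), integral_mollifier]
  simp

theorem enorm_mollify_le {f : E → F} (hf : AEStronglyMeasurable f) (n : ℕ) (x : E) :
    ‖mollify n f x‖ₑ ≤ ∫⁻ t, ‖f (x - t)‖ₑ ∂(mollifierMeasure E n) := by
  rw [mollify_apply, mollifierMeasure, lintegral_withDensity_eq_lintegral_mul₀
    (contDiff_mollifier n).continuous.measurable.ennreal_ofReal.aemeasurable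
    (g := fun t => ‖f (x - t)‖ₑ)
    (hf.comp_measurePreserving (Measure.measurePreserving_sub_left volume x)).enorm]
  refine (enorm_integral_le_lintegral_enorm _).trans (le_of_eq (lintegral_congr fun t => ?_))
  rw [enorm_smul, Real.enorm_of_nonneg (mollifier_nonneg n t), Pi.mul_apply]

/-- Jensen's inequality for the mollifier as a probability measure, then Tonelli and translation
invariance. -/
theorem lintegral_enorm_mollify_pow_le {f : E → F} (hf : AEStronglyMeasurable f) (n : ℕ) {p : ℕ}
    (hp : p ≠ 0) : ∫⁻ x, ‖mollify n f x‖ₑ ^ p ≤ ∫⁻ x, ‖f x‖ₑ ^ p := by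
  have hac : mollifierMeasure E n ≪ volume := withDensity_absolutelyContinuous _ _
  have hm : AEMeasurable (fun q : E × E => ‖f (q.1 - q.2)‖ₑ ^ p)
      (volume.prod (mollifierMeasure E n)) := by
    have h1 : AEStronglyMeasurable (fun q : E × E => f (q.1 - q.2)) (volume.prod volume) :=
      hf.comp_quasiMeasurePreserving (quasiMeasurePreserving_sub volume volume)
    exact (h1.enorm.pow_const p).mono_ac (Measure.AbsolutelyContinuous.rfl.prod hac)
  calc ∫⁻ x, ‖mollify n f x‖ₑ ^ p
      ≤ ∫⁻ x, ∫⁻ t, ‖f (x - t)‖ₑ ^ p ∂(mollifierMeasure E n) := by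
        refine lintegral_mono fun x => (pow_le_pow_left' (enorm_mollify_le hf n x) p).trans
          (lintegral_pow_le_lintegral_pow ?_ hp)
        exact ((hf.comp_measurePreserving (Measure.measurePreserving_sub_left volume x)).mono_ac hac).enorm
    _ = ∫⁻ t, ∫⁻ x, ‖f (x - t)‖ₑ ^ p ∂volume ∂(mollifierMeasure E n) :=
        lintegral_lintegral_swap hm
    _ = _ := by
        simp_rw [lintegral_sub_right_eq_self (fun x => ‖f x‖ₑ ^ p)]
        simp

theorem tendsto_lintegral_enorm_mollify_sub [CompleteSpace F] {f : E → F} (hf : Integrable f) :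
    Tendsto (fun n => ∫⁻ x, ‖mollify n f x - f x‖ₑ) atTop (𝓝 0) := by
  refine tendsto_lintegral_enorm_sub_of_lintegral_le
    (fun n => (contDiff_mollify hf.locallyIntegrable n).continuous.aestronglyMeasurable)
    hf.aestronglyMeasurable (fun n => ?_) hf.2.ne (ae_tendsto_mollify hf.locallyIntegrable)
  simpa using lintegral_enorm_mollify_pow_le hf.aestronglyMeasurable n one_ne_zero

/-- A mollification is an average over a ball. In the chain rule this keeps the mollified function
in the interval where the outer function is controlled. -/
theorem mollify_mem_Icc {f : E → ℝ} (hf : LocallyIntegrable f) {n : ℕ} {a b : ℝ} {x : E}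
    (h : ∀ᵐ y, y ∈ Metric.closedBall x (1 / (n + 1)) → f y ∈ Set.Icc a b) :
    mollify n f x ∈ Set.Icc a b := by
  have hint : Integrable fun t => mollifier E n t • f (x - t) :=
    (hasCompactSupport_mollifier n).convolutionExists_left (ContinuousLinearMap.lsmul ℝ ℝ)
      (contDiff_mollifier n).continuous hf x
  have h' : ∀ᵐ t, x - t ∈ Metric.closedBall x (1 / (n + 1)) → f (x - t) ∈ Set.Icc a b :=
    (Measure.measurePreserving_sub_left volume x).quasiMeasurePreserving.ae h
  have hc (c : ℝ) : ∫ t, mollifier E n t * c = c := by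
    rw [integral_mul_const, integral_mollifier, one_mul]
  have hz (t : E) (ht : x - t ∉ Metric.closedBall x (1 / (n + 1))) : mollifier E n t = 0 := by
    refine image_eq_zero_of_notMem_tsupport ?_
    rw [tsupport_mollifier]
    simpa [dist_eq_norm] using ht
  rw [mollify_apply]
  constructor
  · rw [← hc a]
    refine integral_mono_ae ((integrable_mollifier n).mul_const a) hint (h'.mono fun t ht => ?_)
    by_cases hm : x - t ∈ Metric.closedBall x (1 / (n + 1))
    · exact mul_le_mul_of_nonneg_left (ht hm).1 (mollifier_nonneg n t)
    · simp [hz t hm]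
  · rw [← hc b]
    refine integral_mono_ae hint ((integrable_mollifier n).mul_const b) (h'.mono fun t ht => ?_)
    by_cases hm : x - t ∈ Metric.closedBall x (1 / (n + 1))
    · exact mul_le_mul_of_nonneg_left (ht hm).2 (mollifier_nonneg n t)
    · simp [hz t hm]

end Mollification

/-! ### Weak gradients, mollification and segments -/

section WeakGradient

open Filter Topology Convolution

variable {d : ℕ} {Ω : Set (EuclideanSpace ℝ (Fin d))} {v : EuclideanSpace ℝ (Fin d) → ℝ}
  {g : EuclideanSpace ℝ (Fin d) → EuclideanSpace ℝ (Fin d)} {n : ℕ}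

/-- Where the mollifier only sees `Ω`, the gradient of the mollification is the mollification of
the weak gradient. -/
theorem HasWeakGradient.hasFDerivAt_mollify (hw : HasWeakGradient Ω v g) (hΩ : IsOpen Ω)
    (hv : IntegrableOn v Ω) (hg : IntegrableOn g Ω) {x : EuclideanSpace ℝ (Fin d)}
    (hx : Metric.closedBall x (1 / (n + 1)) ⊆ Ω) :
    HasFDerivAt (mollify n (Ω.indicator v)) (innerSL ℝ (mollify n (Ω.indicator g) x)) x := by
  set ρ := mollifier (EuclideanSpace ℝ (Fin d)) n with hρ
  have hρs : ContDiff ℝ ∞ ρ := contDiff_mollifier n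
  have hρc : HasCompactSupport ρ := hasCompactSupport_mollifier n
  have hv' : LocallyIntegrable (Ω.indicator v) :=
    (hv.integrable_indicator hΩ.measurableSet).locallyIntegrable
  have hg' : LocallyIntegrable (Ω.indicator g) :=
    (hg.integrable_indicator hΩ.measurableSet).locallyIntegrable
  have hder := hρc.hasFDerivAt_convolution_left (ContinuousLinearMap.lsmul ℝ ℝ)
    (hρs.of_le (by exact_mod_cast le_top)) hv' x
  refine hder.congr_fderiv ?_
  refine ContinuousLinearMap.coe_injective
    ((EuclideanSpace.basisFun (Fin d) ℝ).toBasis.ext fun i => ?_)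
  simp only [OrthonormalBasis.coe_toBasis, EuclideanSpace.basisFun_apply,
    ContinuousLinearMap.coe_coe, innerSL_apply_apply, EuclideanSpace.inner_single_right]
  set e : EuclideanSpace ℝ (Fin d) := EuclideanSpace.single i 1 with he
  -- The reflected and translated mollifier is an admissible test function because its support lies
  -- in the ball around x. Its derivative changes sign, which cancels the sign in the definition of
  -- the weak derivative.
  let ψ : EuclideanSpace ℝ (Fin d) → ℝ := fun y => ρ (x - y)
  have hψs : ContDiff ℝ ∞ ψ := hρs.comp (contDiff_const.sub contDiff_id)
  have hψt : tsupport ψ ⊆ Metric.closedBall x (1 / (n + 1)) := by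
    refine closure_minimal (fun y hy => ?_) Metric.isClosed_closedBall
    have h1 : x - y ∈ tsupport ρ := subset_tsupport _ hy
    rw [hρ, tsupport_mollifier, mem_closedBall_zero_iff] at h1
    rwa [Metric.mem_closedBall, dist_eq_norm, norm_sub_rev]
  have hψc : HasCompactSupport ψ :=
    HasCompactSupport.of_support_subset_isCompact (isCompact_closedBall x (1 / (n + 1)))
      ((subset_tsupport _).trans hψt)
  have hψd (y : EuclideanSpace ℝ (Fin d)) : fderiv ℝ ψ y e = -(fderiv ℝ ρ (x - y) e) := by
    have h1 : HasFDerivAt ψ ((fderiv ℝ ρ (x - y)).comp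
        (-(ContinuousLinearMap.id ℝ (EuclideanSpace ℝ (Fin d))))) y :=
      ((hρs.differentiable (by simp)) (x - y)).hasFDerivAt.comp y
        ((hasFDerivAt_id y).const_sub x)
    rw [h1.fderiv]
    simp
  have hL : ((fderiv ℝ ρ ⋆[(ContinuousLinearMap.lsmul ℝ ℝ).precompL (EuclideanSpace ℝ (Fin d)),
      volume] Ω.indicator v) x) e = ∫ t, fderiv ℝ ρ t e * Ω.indicator v (x - t) := by
    have hc := (hρc.fderiv ℝ).convolutionExists_left
      ((ContinuousLinearMap.lsmul ℝ ℝ : ℝ →L[ℝ] ℝ →L[ℝ] ℝ).precompL (EuclideanSpace ℝ (Fin d)))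
      (hρs.continuous_fderiv (by simp)) hv' x
    rw [convolution_def, ContinuousLinearMap.integral_apply hc]
    simp
  have hR : (mollify n (Ω.indicator g) x) i = ∫ t, ρ t * Ω.indicator (fun y => g y i) (x - t) := by
    have hc : Integrable fun t => ρ t • Ω.indicator g (x - t) :=
      hρc.convolutionExists_left (ContinuousLinearMap.lsmul ℝ ℝ) hρs.continuous hg' x
    rw [mollify_apply]
    refine ((EuclideanSpace.proj (𝕜 := ℝ) i).integral_comp_comm hc).symm.trans ?_
    refine integral_congr_ae (ae_of_all _ fun t => ?_)
    by_cases ht : x - t ∈ Ω <;> simp [ht]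
  have hweak := (hw i).2.2 ψ hψs hψc (hψt.trans hx)
  simp_rw [← he, hψd, mul_neg, integral_neg, neg_inj] at hweak
  have hL' : ∫ t, fderiv ℝ ρ t e * Ω.indicator v (x - t)
      = ∫ y in Ω, v y * fderiv ℝ ρ (x - y) e := by
    rw [← integral_sub_left_eq_self _ volume x, ← integral_indicator hΩ.measurableSet]
    refine integral_congr_ae (ae_of_all _ fun t => ?_)
    by_cases ht : t ∈ Ω <;> simp [ht, mul_comm]
  have hR' : ∫ t, ρ t * Ω.indicator (fun y => g y i) (x - t) = ∫ y in Ω, g y i * ψ y := by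
    rw [← integral_sub_left_eq_self _ volume x, ← integral_indicator hΩ.measurableSet]
    refine integral_congr_ae (ae_of_all _ fun t => ?_)
    by_cases ht : t ∈ Ω <;> simp [ht, mul_comm, ψ]
  rw [hL, hL', hweak, ← hR', ← hR]
  simp

/-- A point of the ball displaced by h from the centre is the convex combination (1 - t)(x + h) +
t(y + h). -/
theorem Convex.closedBall_subset_of_segment {E : Type*} [NormedAddCommGroup E]
    [NormedSpace ℝ E] {s : Set E} (hs : Convex ℝ s) {x y : E} {r : ℝ}
    (hx : Metric.closedBall x r ⊆ s) (hy : Metric.closedBall y r ⊆ s) {t : ℝ} (h0 : 0 ≤ t)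
    (h1 : t ≤ 1) : Metric.closedBall (x + t • (y - x)) r ⊆ s := by
  intro z hz
  set h := z - (x + t • (y - x)) with hh
  have hn : ‖h‖ ≤ r := by rwa [Metric.mem_closedBall, dist_eq_norm] at hz
  have hz' : z = (1 - t) • (x + h) + t • (y + h) := by
    rw [hh]; module
  rw [hz']
  exact hs (hx (by simpa [dist_eq_norm] using hn)) (hy (by simpa [dist_eq_norm] using hn))
    (by linarith) h0 (by ring)

/-- The mollifications of a weakly differentiable function on a convex set satisfy a bound along
the segments that stay away from the boundary. -/
theorem HasWeakGradient.segmentBound_mollify (hw : HasWeakGradient Ω v g) (hΩ : IsOpen Ω)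
    (hc : Convex ℝ Ω) (hv : IntegrableOn v Ω) (hg : IntegrableOn g Ω)
    {B : Set (EuclideanSpace ℝ (Fin d))} {D : ℝ} (hD : ∀ x ∈ Ω, ∀ y ∈ Ω, ‖y - x‖ ≤ D)
    (hB : ∀ y ∈ B, Metric.closedBall y (1 / (n + 1)) ⊆ Ω) {x : EuclideanSpace ℝ (Fin d)}
    (hx : Metric.closedBall x (1 / (n + 1)) ⊆ Ω) {t : ℝ} (ht : 0 ≤ t) (ht1 : t ≤ 1) :
    SegmentBound B (ENNReal.ofReal D) (fun y => ‖mollify n (Ω.indicator v) y‖ₑ)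
      (fun y => ‖mollify n (Ω.indicator g) y‖ₑ) t x := by
  intro y hy
  have hball : (0 : ℝ) ≤ 1 / (n + 1) := by positivity
  have hxΩ : x ∈ Ω := hx (Metric.mem_closedBall_self hball)
  have hyΩ : y ∈ Ω := hB y hy (Metric.mem_closedBall_self hball)
  set V := mollify n (Ω.indicator v) with hV
  set G := mollify n (Ω.indicator g) with hG
  have hGc : Continuous G := (contDiff_mollify
    (hg.integrable_indicator hΩ.measurableSet).locallyIntegrable n).continuous
  -- The segment run through with speed 4tτ³‖y - x‖, as in `SegmentBound`.
  set γ : ℝ → EuclideanSpace ℝ (Fin d) := fun τ => x + (t * τ ^ 4) • (y - x) with hγ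
  have hγd (τ : ℝ) : HasDerivAt γ ((4 * t * τ ^ 3) • (y - x)) τ := by
    have h1 : HasDerivAt (fun τ : ℝ => t * τ ^ 4) (4 * t * τ ^ 3) τ := by
      
      refine ((hasDerivAt_pow 4 τ).const_mul t).congr_deriv ?_
      norm_num; ring
    exact (h1.smul_const (y - x)).const_add x
  have hder (τ : ℝ) (hτ : τ ∈ Set.uIcc (0 : ℝ) 1) :
      HasDerivAt (fun τ => V (γ τ)) (inner ℝ (G (γ τ)) ((4 * t * τ ^ 3) • (y - x))) τ := by
    rw [Set.uIcc_of_le zero_le_one] at hτ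
    have hsub : Metric.closedBall (γ τ) (1 / (n + 1)) ⊆ Ω :=
      hc.closedBall_subset_of_segment hx (hB y hy) (mul_nonneg ht (pow_nonneg hτ.1 4))
        (mul_le_one₀ ht1 (pow_nonneg hτ.1 4) (pow_le_one₀ hτ.1 hτ.2))
    have := (hw.hasFDerivAt_mollify hΩ hv hg hsub).comp_hasDerivAt τ (hγd τ)
    refine this.congr_deriv ?_
    simp [hG, inner_smul_right]
  have hcont : Continuous fun τ : ℝ => inner ℝ (G (γ τ)) ((4 * t * τ ^ 3) • (y - x)) := by
    fun_prop
  have hftc := intervalIntegral.integral_eq_sub_of_hasDerivAt hder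
    (hcont.intervalIntegrable 0 1)
  have h0 : γ 0 = x := by simp [hγ]
  have h1 : γ 1 = x + t • (y - x) := by simp [hγ]
  rw [h0, h1, intervalIntegral.integral_of_le zero_le_one, ← integral_Icc_eq_integral_Ioc] at hftc
  have hVx : V x = V (x + t • (y - x)) -
      ∫ τ in Set.Icc (0 : ℝ) 1, inner ℝ (G (γ τ)) ((4 * t * τ ^ 3) • (y - x)) := by
    rw [hftc]; ring
  calc ‖V x‖ₑ ≤ ‖V (x + t • (y - x))‖ₑ +
        ‖∫ τ in Set.Icc (0 : ℝ) 1, inner ℝ (G (γ τ)) ((4 * t * τ ^ 3) • (y - x))‖ₑ := by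
        rw [hVx]; exact enorm_sub_le
    _ ≤ _ := by
        gcongr
        refine (enorm_integral_le_lintegral_enorm _).trans
          (setLIntegral_mono' measurableSet_Icc fun τ hτ => ?_)
        change _ ≤ ENNReal.ofReal (4 * t * τ ^ 3) * ENNReal.ofReal D * ‖G (γ τ)‖ₑ
        rw [← ofReal_norm, ← ofReal_norm,
          ← ENNReal.ofReal_mul' ((norm_nonneg _).trans (hD x hxΩ y hyΩ)),
          ← ENNReal.ofReal_mul' (norm_nonneg _)]
        refine ENNReal.ofReal_le_ofReal ((norm_inner_le_norm _ _).trans ?_)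
        have h4 : 0 ≤ 4 * t * τ ^ 3 := by have := hτ.1; positivity
        rw [norm_smul, Real.norm_of_nonneg h4, mul_comm]
        gcongr
        exact hD x hxΩ y hyΩ

end WeakGradient

/-! ### Sobolev and Morrey inequalities on bounded convex sets -/

section Consequences

open Filter Topology

variable {d : ℕ} {Ω : Set (EuclideanSpace ℝ (Fin d))} {v : EuclideanSpace ℝ (Fin d) → ℝ}
  {g : EuclideanSpace ℝ (Fin d) → EuclideanSpace ℝ (Fin d)}

theorem lintegral_enorm_indicator_pow {α F : Type*} [MeasurableSpace α] {μ : Measure α}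
    [NormedAddCommGroup F] {s : Set α} (hs : MeasurableSet s) (f : α → F) {p : ℕ} (hp : p ≠ 0) :
    ∫⁻ x, ‖s.indicator f x‖ₑ ^ p ∂μ = ∫⁻ x in s, ‖f x‖ₑ ^ p ∂μ := by
  rw [← lintegral_indicator hs]
  refine lintegral_congr fun x => ?_
  by_cases hx : x ∈ s <;> simp [hx, hp]

/-- The points of `s` at distance more than `1 / (n + 1)` from the complement of `s`. -/
def innerPart {X : Type*} [PseudoMetricSpace X] (s : Set X) (n : ℕ) : Set X :=
  {x | ENNReal.ofReal (1 / (n + 1)) < Metric.infEDist x sᶜ}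

theorem measurableSet_innerPart {X : Type*} [PseudoMetricSpace X] [MeasurableSpace X]
    [BorelSpace X] (s : Set X) (n : ℕ) : MeasurableSet (innerPart s n) :=
  measurableSet_lt measurable_const measurable_infEDist

theorem closedBall_subset_of_mem_innerPart {X : Type*} [PseudoMetricSpace X] {s : Set X} {n : ℕ}
    {x : X} (hx : x ∈ innerPart s n) : Metric.closedBall x (1 / (n + 1)) ⊆ s := by
  intro z hz
  by_contra hzs
  have h1 : Metric.infEDist x sᶜ ≤ edist x z := Metric.infEDist_le_edist_of_mem hzs
  rw [edist_dist, dist_comm] at h1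
  exact (hx.trans_le h1).not_ge (ENNReal.ofReal_le_ofReal (Metric.mem_closedBall.1 hz))

theorem innerPart_subset {X : Type*} [PseudoMetricSpace X] {s : Set X} {n : ℕ} :
    innerPart s n ⊆ s := fun _ hx =>
  closedBall_subset_of_mem_innerPart hx (Metric.mem_closedBall_self (by positivity))

theorem IsCompact.eventually_closedBall_subset {X : Type*} [PseudoMetricSpace X] {K s : Set X}
    (hK : IsCompact K) (hs : IsOpen s) (hKs : K ⊆ s) :
    ∀ᶠ n : ℕ in atTop, ∀ x ∈ K, Metric.closedBall x (1 / (n + 1)) ⊆ s := by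
  obtain ⟨δ, hδ, hsub⟩ := hK.exists_cthickening_subset_open hs hKs
  filter_upwards [tendsto_one_div_add_atTop_nhds_zero_nat.eventually_lt_const hδ] with n hn x hx
  exact (Metric.closedBall_subset_closedBall hn.le).trans
    ((Metric.closedBall_subset_cthickening hx δ).trans hsub)

theorem IsOpen.eventually_mem_innerPart {X : Type*} [PseudoMetricSpace X] {s : Set X}
    (hs : IsOpen s) {x : X} (hx : x ∈ s) : ∀ᶠ n : ℕ in atTop, x ∈ innerPart s n := by
  have h1 : 0 < Metric.infEDist x sᶜ := by
    rw [pos_iff_ne_zero, Ne, ← Metric.mem_closure_iff_infEDist_zero,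
      hs.isClosed_compl.closure_eq]
    simpa using hx
  have h2 : Tendsto (fun n : ℕ => ENNReal.ofReal (1 / (n + 1))) atTop (𝓝 0) := by
    simpa using ENNReal.tendsto_ofReal tendsto_one_div_add_atTop_nhds_zero_nat
  exact h2.eventually_lt_const h1

/-- The uniform probability measure on a small ball inside a nonempty open set. -/
theorem IsOpen.exists_isProbabilityMeasure_le (hΩ : IsOpen Ω) (hne : Ω.Nonempty) :
    ∃ (B : Set (EuclideanSpace ℝ (Fin d))) (ν : Measure (EuclideanSpace ℝ (Fin d)))
      (b : ENNReal), IsProbabilityMeasure ν ∧ ν ≤ b • volume ∧ b ≠ ⊤ ∧ (∀ᵐ y ∂ν, y ∈ B) ∧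
        ∀ᶠ n : ℕ in atTop, ∀ y ∈ B, Metric.closedBall y (1 / (n + 1)) ⊆ Ω := by
  obtain ⟨x, hx⟩ := hne
  obtain ⟨r, hr, hsub⟩ := Metric.nhds_basis_closedBall.mem_iff.1 (hΩ.mem_nhds hx)
  have h0 : volume (Metric.closedBall x r) ≠ 0 := (Metric.measure_closedBall_pos _ x hr).ne'
  have h1 : volume (Metric.closedBall x r) ≠ ⊤ := measure_closedBall_lt_top.ne
  refine ⟨Metric.closedBall x r,
    (volume (Metric.closedBall x r))⁻¹ • volume.restrict (Metric.closedBall x r),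
    (volume (Metric.closedBall x r))⁻¹, ⟨?_⟩, ?_, ENNReal.inv_ne_top.2 h0, ?_,
    (isCompact_closedBall x r).eventually_closedBall_subset hΩ hsub⟩
  · simp [ENNReal.inv_mul_cancel h0 h1]
  · gcongr
    exact Measure.restrict_le_self
  · exact Measure.ae_smul_measure (ae_restrict_mem Metric.isClosed_closedBall.measurableSet) _

theorem measurable_enorm_mollify_indicator {F : Type*} [NormedAddCommGroup F] [NormedSpace ℝ F]
    [CompleteSpace F] {f : EuclideanSpace ℝ (Fin d) → F} (hΩ : IsOpen Ω) (hf : IntegrableOn f Ω)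
    (n : ℕ) : Measurable fun y => ‖mollify n (Ω.indicator f) y‖ₑ :=
  (contDiff_mollify (hf.integrable_indicator hΩ.measurableSet).locallyIntegrable
    n).continuous.enorm.measurable

theorem ae_tendsto_mollify_indicator {F : Type*} [NormedAddCommGroup F] [NormedSpace ℝ F]
    [CompleteSpace F] {f : EuclideanSpace ℝ (Fin d) → F} (hΩ : IsOpen Ω)
    (hf : IntegrableOn f Ω) :
    ∀ᵐ x ∂(volume.restrict Ω), Tendsto (fun n => mollify n (Ω.indicator f) x) atTop (𝓝 (f x)) := by
  rw [ae_restrict_iff' hΩ.measurableSet]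
  filter_upwards [ae_tendsto_mollify
    (hf.integrable_indicator hΩ.measurableSet).locallyIntegrable] with x hx hxΩ
  rwa [Set.indicator_of_mem hxΩ] at hx

theorem lintegral_enorm_mollify_indicator_pow_le {F : Type*} [NormedAddCommGroup F]
    [NormedSpace ℝ F] {f : EuclideanSpace ℝ (Fin d) → F} (hΩ : IsOpen Ω)
    (hf : IntegrableOn f Ω) (n : ℕ) {p : ℕ} (hp : p ≠ 0) :
    ∫⁻ x, ‖mollify n (Ω.indicator f) x‖ₑ ^ p ≤ ∫⁻ x in Ω, ‖f x‖ₑ ^ p :=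
  (lintegral_enorm_mollify_pow_le
    (hf.integrable_indicator hΩ.measurableSet).aestronglyMeasurable n hp).trans
    (lintegral_enorm_indicator_pow hΩ.measurableSet f hp).le

/-- On a bounded convex open set of dimension at most three, an integrable function with square
integrable weak gradient belongs to `L⁴`. -/
theorem HasWeakGradient.lintegral_pow_four_lt_top (hw : HasWeakGradient Ω v g) (hd : d ≤ 3)
    (hΩ : IsOpen Ω) (hc : Convex ℝ Ω) (hb : Bornology.IsBounded Ω) (hv : IntegrableOn v Ω)
    (hg : IntegrableOn g Ω) (hg2 : ∫⁻ x in Ω, ‖g x‖ₑ ^ 2 ≠ ⊤) :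
    ∫⁻ x in Ω, ‖v x‖ₑ ^ 4 < ⊤ := by
  rcases Ω.eq_empty_or_nonempty with rfl | hne
  · simp
  obtain ⟨B, ν, b, hν, hνb, hbt, hB, hBΩ⟩ := hΩ.exists_isProbabilityMeasure_le hne
  obtain ⟨D, hD⟩ := Metric.isBounded_iff.1 hb
  have hD' : ∀ x ∈ Ω, ∀ y ∈ Ω, ‖y - x‖ ≤ D := fun x hx y hy => by
    rw [← dist_eq_norm]; exact hD hy hx
  set C : ENNReal := 8 * ((b * (8 * ∫⁻ y in Ω, ‖v y‖ₑ)) ^ 4 * volume Ω +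
      ENNReal.ofReal D ^ 4 * 128 * (8 * b) * (∫⁻ y in Ω, ‖g y‖ₑ ^ 2) ^ 2) with hC
  have hvt : ∫⁻ y in Ω, ‖v y‖ₑ ≠ ⊤ := hv.2.ne
  have hΩt : volume Ω ≠ ⊤ := hb.measure_lt_top.ne
  have hCt : C < ⊤ := by rw [hC]; finiteness
  refine lt_of_le_of_lt ?_ hCt
  set V : ℕ → EuclideanSpace ℝ (Fin d) → ENNReal := fun n x =>
    ‖mollify n (Ω.indicator v) x‖ₑ with hV
  have hVm (n : ℕ) : Measurable (V n) := measurable_enorm_mollify_indicator hΩ hv n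
  -- The mollified estimate holds only on the inner part, so the integrand is cut off there.
  -- Mollification does not increase the norms, so C is independent of n.
  have hn : ∀ᶠ n : ℕ in atTop, ∫⁻ x in Ω, (innerPart Ω n).indicator (fun x => V n x ^ 4) x ≤ C := by
    filter_upwards [hBΩ] with n hn
    rw [setLIntegral_indicator (measurableSet_innerPart Ω n),
      Set.inter_eq_self_of_subset_left innerPart_subset]
    refine (SegmentBound.sobolev hνb (by simpa using hd) hB (hVm n)
      (measurable_enorm_mollify_indicator hΩ hg n) (measurableSet_innerPart Ω n) fun x hx =>
      hw.segmentBound_mollify hΩ hc hv hg hD' hn (closedBall_subset_of_mem_innerPart hx)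
        (by norm_num) (by norm_num)).trans ?_
    rw [hC]
    have e1 : ∫⁻ x, V n x ≤ ∫⁻ x in Ω, ‖v x‖ₑ := by
      simpa using lintegral_enorm_mollify_indicator_pow_le hΩ hv n one_ne_zero
    have e2 := lintegral_enorm_mollify_indicator_pow_le hΩ hg n two_ne_zero
    have e3 : volume (innerPart Ω n) ≤ volume Ω := measure_mono innerPart_subset
    exact mul_le_mul_right (add_le_add
      (mul_le_mul' (pow_le_pow_left' (mul_le_mul_right (mul_le_mul_right e1 _) _) 4) e3)
      (mul_le_mul_right (pow_le_pow_left' e2 2) _)) _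
  -- Each point of Ω eventually lies in the inner part, so the cut-offs converge almost everywhere
  -- and Fatou's lemma applies.
  calc ∫⁻ x in Ω, ‖v x‖ₑ ^ 4
      = ∫⁻ x in Ω, liminf (fun n => (innerPart Ω n).indicator (fun x => V n x ^ 4) x) atTop := by
        refine lintegral_congr_ae ?_
        filter_upwards [ae_tendsto_mollify_indicator hΩ hv, ae_restrict_mem hΩ.measurableSet]
          with x hx hxΩ
        refine (Tendsto.liminf_eq ?_).symm
        refine Tendsto.congr' ?_ ((ENNReal.continuous_pow 4).continuousAt.tendsto.comp
          (continuous_enorm.continuousAt.tendsto.comp hx))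
        filter_upwards [hΩ.eventually_mem_innerPart hxΩ] with n hn
        rw [Set.indicator_of_mem hn]
        rfl
    _ ≤ liminf (fun n => ∫⁻ x in Ω, (innerPart Ω n).indicator (fun x => V n x ^ 4) x) atTop :=
        lintegral_liminf_le fun n =>
          ((hVm n).pow_const 4).indicator (measurableSet_innerPart Ω n)
    _ ≤ C := liminf_le_of_frequently_le' hn.frequently

/-- A Morrey inequality with a free parameter on a bounded convex open set of dimension at most
three. -/
theorem exists_morrey_const (hd : d ≤ 3) (hΩ : IsOpen Ω) (hc : Convex ℝ Ω)
    (hb : Bornology.IsBounded Ω) (hne : Ω.Nonempty) :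
    ∃ C : NNReal, ∀ (v : EuclideanSpace ℝ (Fin d) → ℝ)
      (g : EuclideanSpace ℝ (Fin d) → EuclideanSpace ℝ (Fin d)), HasWeakGradient Ω v g →
      IntegrableOn v Ω → IntegrableOn g Ω → ∀ t : ℝ, 0 < t → t ≤ 1 →
      ∀ᵐ x ∂(volume.restrict Ω), ‖v x‖ₑ ^ 4 ≤
        C * (ENNReal.ofReal ((t ^ 3)⁻¹) * (∫⁻ y in Ω, ‖v y‖ₑ ^ 4) +
          ENNReal.ofReal t * ∫⁻ y in Ω, ‖g y‖ₑ ^ 4) := by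
  obtain ⟨B, ν, b, hν, hνb, hbt, hB, hBΩ⟩ := hΩ.exists_isProbabilityMeasure_le hne
  obtain ⟨D, hD⟩ := Metric.isBounded_iff.1 hb
  have hD' : ∀ x ∈ Ω, ∀ y ∈ Ω, ‖y - x‖ ≤ D := fun x hx y hy => by
    rw [← dist_eq_norm]; exact hD hy hx
  set C : ENNReal := 8 * b + 8 * (ENNReal.ofReal D ^ 4 * 256 * b) with hC
  have hCt : C ≠ ⊤ := by rw [hC]; finiteness
  refine ⟨C.toNNReal, fun v g hw hv hg t ht ht1 => ?_⟩
  rw [ENNReal.coe_toNNReal hCt]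
  filter_upwards [ae_tendsto_mollify_indicator hΩ hv, ae_restrict_mem hΩ.measurableSet]
    with x hx hxΩ
  refine le_of_tendsto ((ENNReal.continuous_pow 4).continuousAt.tendsto.comp
    (continuous_enorm.continuousAt.tendsto.comp hx)) ?_
  filter_upwards [hΩ.eventually_mem_innerPart hxΩ, hBΩ] with n hn hBn
  refine (SegmentBound.morrey hνb (by simpa using hd) hB
      (measurable_enorm_mollify_indicator hΩ hv n) (measurable_enorm_mollify_indicator hΩ hg n)
      ht ht1 (hw.segmentBound_mollify hΩ hc hv hg hD' hBn (closedBall_subset_of_mem_innerPart hn)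
        ht.le ht1)).trans ?_
  have e1 := lintegral_enorm_mollify_indicator_pow_le hΩ hv n four_ne_zero
  have e2 := lintegral_enorm_mollify_indicator_pow_le hΩ hg n four_ne_zero
  rw [ENNReal.ofReal_mul (by norm_num), show ENNReal.ofReal 256 = 256 by simp]
  calc _ ≤ 8 * (b * ENNReal.ofReal (t ^ 3)⁻¹ * ∫⁻ y in Ω, ‖v y‖ₑ ^ 4) +
        8 * (ENNReal.ofReal D ^ 4 * (256 * ENNReal.ofReal t) * (b * ∫⁻ y in Ω, ‖g y‖ₑ ^ 4)) := by
        gcongr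
    _ = (8 * b) * (ENNReal.ofReal (t ^ 3)⁻¹ * ∫⁻ y in Ω, ‖v y‖ₑ ^ 4) +
        (8 * (ENNReal.ofReal D ^ 4 * 256 * b)) * (ENNReal.ofReal t * ∫⁻ y in Ω, ‖g y‖ₑ ^ 4) := by
        ring
    _ ≤ _ := by
        rw [mul_add, hC]
        gcongr
        · exact le_self_add
        · exact le_add_self

end Consequences

/-! ### Uniqueness of weak gradients and the chain rule -/

section ChainRule

open Filter Topology

/-- Products of boundedly convergent and `L¹` convergent sequences: convergence of integrals. -/
theorem tendsto_integral_mul_of_tendsto_lintegral_enorm_sub {α : Type*} [MeasurableSpace α]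
    {μ : Measure α} {c h : ℕ → α → ℝ} {c' h' : α → ℝ} {C : ℝ}
    (hc : ∀ᶠ n in atTop, AEStronglyMeasurable (c n) μ)
    (hC : ∀ᶠ n in atTop, ∀ᵐ x ∂μ, ‖c n x‖ ≤ C)
    (hlim : ∀ᵐ x ∂μ, Tendsto (fun n => c n x) atTop (𝓝 (c' x)))
    (hh : ∀ n, Integrable (h n) μ) (hh' : Integrable h' μ)
    (hL : Tendsto (fun n => ∫⁻ x, ‖h n x - h' x‖ₑ ∂μ) atTop (𝓝 0)) :
    Tendsto (fun n => ∫ x, c n x * h n x ∂μ) atTop (𝓝 (∫ x, c' x * h' x ∂μ)) := by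
  have h1 : Tendsto (fun n => ∫ x, c n x * h' x ∂μ) atTop (𝓝 (∫ x, c' x * h' x ∂μ)) := by
    refine tendsto_integral_filter_of_dominated_convergence (fun x => C * ‖h' x‖) ?_ ?_
      (hh'.norm.const_mul C) ?_
    · filter_upwards [hc] with n hn using hn.mul hh'.aestronglyMeasurable
    · filter_upwards [hC] with n hn
      filter_upwards [hn] with x hx
      rw [norm_mul]; gcongr
    · filter_upwards [hlim] with x hx using hx.mul_const _
  -- The integral splits as c(h - h') + c h': the first part vanishes by the bound on c and L¹
  -- convergence, the second is handled by dominated convergence above.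
  have h2 : Tendsto (fun n => ∫ x, c n x * (h n x - h' x) ∂μ) atTop (𝓝 0) := by
    rw [tendsto_zero_iff_enorm_tendsto_zero]
    have h3 : Tendsto (fun n => ENNReal.ofReal C * ∫⁻ x, ‖h n x - h' x‖ₑ ∂μ) atTop (𝓝 0) := by
      simpa using ENNReal.Tendsto.const_mul hL (Or.inr ENNReal.ofReal_ne_top)
    refine tendsto_of_tendsto_of_tendsto_of_le_of_le' tendsto_const_nhds h3
      (Eventually.of_forall fun _ => zero_le) ?_
    filter_upwards [hC] with n hn
    refine (enorm_integral_le_lintegral_enorm _).trans ?_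
    rw [← lintegral_const_mul' _ _ ENNReal.ofReal_ne_top]
    refine lintegral_mono_ae ?_
    filter_upwards [hn] with x hx
    rw [enorm_mul, ← ofReal_norm (c n x)]
    gcongr
  have h4 := h2.add h1
  rw [zero_add] at h4
  refine h4.congr' ?_
  filter_upwards [hc, hC] with n hn hCn
  have i1 : Integrable (fun x => c n x * (h n x - h' x)) μ := ((hh n).sub hh').bdd_mul hn hCn
  have i2 : Integrable (fun x => c n x * h' x) μ := hh'.bdd_mul hn hCn
  rw [← integral_add i1 i2]
  refine integral_congr_ae (ae_of_all _ fun x => ?_)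
  simp only
  ring

variable {d : ℕ} {Ω : Set (EuclideanSpace ℝ (Fin d))} {u : EuclideanSpace ℝ (Fin d) → ℝ}
  {g g' : EuclideanSpace ℝ (Fin d) → EuclideanSpace ℝ (Fin d)}

theorem integrable_mul_of_locallyIntegrableOn {f φ : EuclideanSpace ℝ (Fin d) → ℝ}
    (hf : LocallyIntegrableOn f Ω) (hφ : Continuous φ) (hc : HasCompactSupport φ)
    (hs : tsupport φ ⊆ Ω) : Integrable fun x => f x * φ x := by
  rw [← integrableOn_iff_integrable_of_support_subset (s := tsupport φ)]
  · exact (hf.integrableOn_compact_subset hs hc).mul_continuousOn hφ.continuousOn hc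
  · exact (Function.support_mul_subset_right _ _).trans (subset_tsupport φ)

/-- By the fundamental lemma of the calculus of variations. It transfers the estimate from the
gradients constructed in the proof to arbitrary weak gradients of u and log u. -/
theorem HasWeakGradient.ae_eq (hΩ : IsOpen Ω) (h : HasWeakGradient Ω u g)
    (h' : HasWeakGradient Ω u g') : g =ᵐ[volume.restrict Ω] g' := by
  have key (i : Fin d) : ∀ᵐ x, x ∈ Ω → g x i - g' x i = 0 := by
    refine hΩ.ae_eq_zero_of_integral_contDiff_smul_eq_zero (μ := volume)
      (f := fun x => g x i - g' x i) ((h i).2.1.sub (h' i).2.1) fun φ hφ hc hs => ?_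
    have e1 := (h i).2.2 φ hφ hc hs
    rw [(h' i).2.2 φ hφ hc hs, neg_inj] at e1
    have i1 := integrable_mul_of_locallyIntegrableOn (h i).2.1 hφ.continuous hc hs
    have i2 := integrable_mul_of_locallyIntegrableOn (h' i).2.1 hφ.continuous hc hs
    have hz (f : EuclideanSpace ℝ (Fin d) → ℝ) :
        ∫ x in Ω, f x * φ x = ∫ x, f x * φ x :=
      setIntegral_eq_integral_of_forall_compl_eq_zero fun x hx => by
        rw [image_eq_zero_of_notMem_tsupport fun hx' => hx (hs hx'), mul_zero]
    rw [hz, hz] at e1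
    calc ∫ x, φ x • (g x i - g' x i) = ∫ x, (g x i * φ x - g' x i * φ x) := by
          refine integral_congr_ae (ae_of_all _ fun x => ?_)
          simp only [smul_eq_mul]; ring
      _ = 0 := by rw [integral_sub i1 i2, e1, sub_self]
  rw [Filter.EventuallyEq, ae_restrict_iff' hΩ.measurableSet]
  filter_upwards [ae_all_iff.2 key] with x hx hxΩ
  ext i
  exact sub_eq_zero.1 (hx i hxΩ)

/-- The chain rule for weak gradients of functions with values in a compact interval. -/
theorem HasWeakGradient.comp (hw : HasWeakGradient Ω u g) (hΩ : IsOpen Ω)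
    (hu : IntegrableOn u Ω) (hg : IntegrableOn g Ω) {a b : ℝ}
    (hab : ∀ᵐ x ∂(volume.restrict Ω), u x ∈ Set.Icc a b) {F F' : ℝ → ℝ}
    (hF : ∀ y ∈ Set.Icc a b, HasDerivAt F (F' y) y) (hF' : ContinuousOn F' (Set.Icc a b))
    (hFm : Measurable F) (hFm' : Measurable F') :
    HasWeakGradient Ω (fun x => F (u x)) (fun x => F' (u x) • g x) := by
  intro i
  have hFc : ContinuousOn F (Set.Icc a b) := fun y hy => (hF y hy).continuousAt.continuousWithinAt
  obtain ⟨C, hC⟩ := isCompact_Icc.exists_bound_of_continuousOn hFc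
  obtain ⟨C', hC'⟩ := isCompact_Icc.exists_bound_of_continuousOn hF'
  have hum : AEMeasurable u (volume.restrict Ω) := hu.aemeasurable
  have hgi : IntegrableOn (fun x => g x i) Ω :=
    (EuclideanSpace.proj (𝕜 := ℝ) i : EuclideanSpace ℝ (Fin d) →L[ℝ] ℝ).integrable_comp hg
  have hFu : LocallyIntegrableOn (fun x => F (u x)) Ω := by
    intro x hx
    refine ⟨Ω ∩ Metric.ball x 1, inter_mem_nhdsWithin _ (Metric.ball_mem_nhds x one_pos), ?_⟩
    have : IsFiniteMeasure (volume.restrict (Ω ∩ Metric.ball x 1)) :=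
      ⟨by rw [Measure.restrict_apply_univ]
          exact (measure_mono Set.inter_subset_right).trans_lt measure_ball_lt_top⟩
    refine Integrable.of_bound (C := C) ((hFm.comp_aemeasurable
      (hum.mono_measure (Measure.restrict_mono Set.inter_subset_left le_rfl))).aestronglyMeasurable)
      ((ae_restrict_of_ae_restrict_of_subset Set.inter_subset_left hab).mono fun y hy => hC _ hy)
  have hFg : IntegrableOn (fun x => (F' (u x) • g x) i) Ω := by
    refine Integrable.bdd_mul (c := C') hgi
      (hFm'.comp_aemeasurable hum).aestronglyMeasurable (hab.mono fun y hy => hC' _ hy)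
  refine ⟨hFu, hFg.locallyIntegrableOn, fun φ hφ hc hs => ?_⟩
  set e : EuclideanSpace ℝ (Fin d) := EuclideanSpace.single i 1 with he
  set K := tsupport φ with hK
  have hKm : MeasurableSet K := (isClosed_tsupport φ).measurableSet
  set U : ℕ → EuclideanSpace ℝ (Fin d) → ℝ := fun n => mollify n (Ω.indicator u) with hU
  set G : ℕ → EuclideanSpace ℝ (Fin d) → EuclideanSpace ℝ (Fin d) :=
    fun n => mollify n (Ω.indicator g) with hG
  have hu' := hu.integrable_indicator hΩ.measurableSet
  have hg' := hg.integrable_indicator hΩ.measurableSet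
  have hUc (n : ℕ) : Continuous (U n) := (contDiff_mollify hu'.locallyIntegrable n).continuous
  have hGc (n : ℕ) : Continuous (G n) := (contDiff_mollify hg'.locallyIntegrable n).continuous
  have hev := IsCompact.eventually_closedBall_subset (K := K) hc hΩ hs
  have hUI : ∀ᶠ n in atTop, ∀ x ∈ K, U n x ∈ Set.Icc a b := by
    filter_upwards [hev] with n hn x hx
    refine mollify_mem_Icc hu'.locallyIntegrable ?_
    rw [ae_restrict_iff' hΩ.measurableSet] at hab
    filter_upwards [hab] with y hy hyb
    rw [Set.indicator_of_mem (hn x hx hyb)]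
    exact hy (hn x hx hyb)
  have hder : Continuous fun x => fderiv ℝ φ x e := by
    have := hφ.continuous_fderiv (by simp)
    fun_prop
  have hderz (x) (hx : x ∉ K) : fderiv ℝ φ x e = 0 := by
    rw [image_eq_zero_of_notMem_tsupport fun h => hx (tsupport_fderiv_subset ℝ h)]; rfl
  have hφz (x) (hx : x ∉ K) : φ x = 0 := image_eq_zero_of_notMem_tsupport hx
  -- Classical integration by parts for F composed with the mollification. The classical chain rule
  -- is available only on the support of φ; off it, all three products in the formula vanish.
  have hsmooth : ∀ᶠ n in atTop, ∫ x in K, F (U n x) * fderiv ℝ φ x e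
      = -∫ x in K, (F' (U n x) * φ x) * G n x i := by
    filter_upwards [hev, hUI] with n hn hUn
    have hcomp : ContinuousOn (fun x => F (U n x)) K := hFc.comp (hUc n).continuousOn hUn
    have hcomp' : ContinuousOn (fun x => F' (U n x)) K := hF'.comp (hUc n).continuousOn hUn
    have hGi : Continuous fun x => G n x i := by fun_prop
    have hint {f : EuclideanSpace ℝ (Fin d) → ℝ} (hf : ContinuousOn f K)
        (hz : ∀ x, x ∉ K → f x = 0) : Integrable f :=
      (integrableOn_iff_integrable_of_support_subset fun x hx => by
        by_contra h; exact hx (hz x h)).1 (hf.integrableOn_compact hc)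
    have hline (x) (hx : x ∈ K) :
        HasLineDerivAt ℝ (fun x => F (U n x)) (F' (U n x) * G n x i) x e := by
      have h1 := (hF _ (hUn x hx)).comp_hasFDerivAt x
        (hw.hasFDerivAt_mollify hΩ hu hg (hn x hx))
      have h2 := h1.hasLineDerivAt e
      have h3 : (F' (U n x) • innerSL ℝ (mollify n (Ω.indicator g) x)) e
          = F' (U n x) * G n x i := by
        simp [he, hG, EuclideanSpace.inner_single_right]
      rw [← h3]
      exact h2
    have := integral_bilinear_hasLineDerivAt_right_eq_neg_left_of_integrable
      (μ := volume) (B := ContinuousLinearMap.mul ℝ ℝ) (f := fun x => F (U n x))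
      (f' := fun x => F' (U n x) * G n x i) (g := φ) (g' := fun x => fderiv ℝ φ x e) (v := e)
      (hint ((hcomp'.mul hGi.continuousOn).mul hφ.continuous.continuousOn)
        fun x hx => by simp [hφz x hx])
      (hint (hcomp.mul hder.continuousOn) fun x hx => by simp [hderz x hx])
      (hint (hcomp.mul hφ.continuous.continuousOn) fun x hx => by simp [hφz x hx])
      hline (fun x _ => ((hφ.differentiable (by simp)) x).hasFDerivAt.hasLineDerivAt e)
    simp only [ContinuousLinearMap.mul_apply'] at this
    rw [setIntegral_eq_integral_of_forall_compl_eq_zero fun x hx => by rw [hderz x hx, mul_zero],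
      setIntegral_eq_integral_of_forall_compl_eq_zero fun x hx => by
        rw [hφz x hx, mul_zero, zero_mul], this]
    congr 1
    refine integral_congr_ae (ae_of_all _ fun x => ?_)
    simp only
    ring
  have habK : ∀ᵐ x ∂(volume.restrict K), u x ∈ Set.Icc a b :=
    ae_restrict_of_ae_restrict_of_subset hs hab
  have hlimK : ∀ᵐ x ∂(volume.restrict K), Tendsto (fun n => U n x) atTop (𝓝 (u x)) :=
    ae_restrict_of_ae_restrict_of_subset hs (ae_tendsto_mollify_indicator hΩ hu)
  have hcompl {f : ℝ → ℝ} (hf : ContinuousOn f (Set.Icc a b)) :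
      ∀ᵐ x ∂(volume.restrict K), Tendsto (fun n => f (U n x)) atTop (𝓝 (f (u x))) := by
    filter_upwards [habK, hlimK, ae_restrict_mem hKm] with x hx hxl hxK
    exact (hf _ hx).tendsto.comp (tendsto_nhdsWithin_iff.2
      ⟨hxl, hUI.mono fun n hn => hn x hxK⟩)
  obtain ⟨M, hM⟩ := hφ.continuous.bounded_above_of_compact_support hc
  have hderK : Integrable (fun x => fderiv ℝ φ x e) (volume.restrict K) :=
    hder.continuousOn.integrableOn_compact hc
  have hleft : Tendsto (fun n => ∫ x in K, F (U n x) * fderiv ℝ φ x e) atTop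
      (𝓝 (∫ x in K, F (u x) * fderiv ℝ φ x e)) := by
    refine tendsto_integral_mul_of_tendsto_lintegral_enorm_sub (C := C)
      (h := fun _ x => fderiv ℝ φ x e) (Eventually.of_forall fun n =>
        (hFm.comp (hUc n).measurable).aestronglyMeasurable) ?_ (hcompl hFc)
      (fun _ => hderK) hderK (by simp)
    filter_upwards [hUI] with n hn
    filter_upwards [ae_restrict_mem hKm] with x hx using hC _ (hn x hx)
  -- The coefficients F'(Uₙ)φ are bounded and converge almost everywhere, while the mollified
  -- gradients converge in L¹.
  have hright : Tendsto (fun n => ∫ x in K, (F' (U n x) * φ x) * G n x i) atTop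
      (𝓝 (∫ x in K, (F' (u x) * φ x) * g x i)) := by
    refine tendsto_integral_mul_of_tendsto_lintegral_enorm_sub (C := C' * M)
      (Eventually.of_forall fun n => ((hFm'.comp (hUc n).measurable).mul
        hφ.continuous.measurable).aestronglyMeasurable) ?_ ?_
      (fun n => (show Continuous fun x => G n x i by fun_prop).continuousOn.integrableOn_compact hc)
      (hgi.mono_set hs) ?_
    · filter_upwards [hUI] with n hn
      filter_upwards [ae_restrict_mem hKm] with x hx
      rw [norm_mul]
      exact mul_le_mul (hC' _ (hn x hx)) (hM x) (norm_nonneg _)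
        ((norm_nonneg _).trans (hC' _ (hn x hx)))
    · filter_upwards [hcompl hF'] with x hx using hx.mul_const _
    · refine tendsto_of_tendsto_of_tendsto_of_le_of_le tendsto_const_nhds
        (tendsto_lintegral_enorm_mollify_sub hg') (fun _ => zero_le) fun n => ?_
      refine le_trans ?_ (setLIntegral_le_lintegral K _)
      refine setLIntegral_mono' hKm fun x hx => ?_
      rw [Set.indicator_of_mem (hs hx), ← ofReal_norm, ← ofReal_norm]
      exact ENNReal.ofReal_le_ofReal (PiLp.norm_apply_le (G n x - g x) i)
  have hfinal := tendsto_nhds_unique (hleft.congr' hsmooth) hright.neg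
  have hset {f : EuclideanSpace ℝ (Fin d) → ℝ} (hz : ∀ x, x ∉ K → f x = 0) :
      ∫ x in Ω, f x = ∫ x in K, f x := by
    rw [setIntegral_eq_integral_of_forall_compl_eq_zero fun x hx => hz x hx,
      setIntegral_eq_integral_of_forall_compl_eq_zero fun x hx => hz x fun h => hx (hs h)]
  rw [hset fun x hx => by rw [hderz x hx, mul_zero], hset fun x hx => by rw [hφz x hx, mul_zero],
    hfinal]
  congr 1
  refine integral_congr_ae (ae_of_all _ fun x => ?_)
  simp only [PiLp.smul_apply, smul_eq_mul]
  ring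

end ChainRule

/-! ### Interpolation through the square root -/

section Interpolation

variable {d : ℕ} {Ω : Set (EuclideanSpace ℝ (Fin d))} {u : EuclideanSpace ℝ (Fin d) → ℝ}
  {g : EuclideanSpace ℝ (Fin d) → EuclideanSpace ℝ (Fin d)} {k : ℝ}

theorem eLpNorm_two_sq_eq_lintegral {α F : Type*} [MeasurableSpace α] {μ : Measure α}
    [NormedAddCommGroup F] (f : α → F) : eLpNorm f 2 μ ^ 2 = ∫⁻ x, ‖f x‖ₑ ^ 2 ∂μ := by
  have := eLpNorm_nnreal_pow_eq_lintegral (f := f) (μ := μ) (p := 2) two_ne_zero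
  rw [← ENNReal.rpow_two]
  simpa using this

theorem toReal_eLpNorm_two_sq {α : Type*} [MeasurableSpace α] {μ : Measure α} {f : α → ℝ}
    (hf : MemLp f 2 μ) : (eLpNorm f 2 μ).toReal ^ 2 = ∫ x, f x ^ 2 ∂μ := by
  rw [← ENNReal.toReal_pow, eLpNorm_two_sq_eq_lintegral,
    integral_eq_lintegral_of_nonneg_ae (Filter.Eventually.of_forall fun x => sq_nonneg (f x))
      (hf.1.pow 2)]
  congr 1
  refine lintegral_congr fun x => ?_
  rw [← enorm_pow, Real.enorm_of_nonneg (sq_nonneg _)]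

/-- In dimension at most three, first derivatives of functions in `H²` belong to `L⁴`. -/
theorem integrableOn_norm_pow_four (hd : d ≤ 3) (hΩ : IsOpen Ω) (hc : Convex ℝ Ω)
    (hb : Bornology.IsBounded Ω) (hg : MemLp g 2 (volume.restrict Ω))
    (hh : ∀ i : Fin d, ∃ h : EuclideanSpace ℝ (Fin d) → EuclideanSpace ℝ (Fin d),
      HasWeakGradient Ω (fun x => g x i) h ∧ MemLp h 2 (volume.restrict Ω)) :
    IntegrableOn (fun x => ‖g x‖ ^ 4) Ω := by
  have : IsFiniteMeasure (volume.restrict Ω) :=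
    ⟨by rw [Measure.restrict_apply_univ]; exact hb.measure_lt_top⟩
  have hgi (i : Fin d) : IntegrableOn (fun x => g x i) Ω :=
    (EuclideanSpace.proj (𝕜 := ℝ) i : EuclideanSpace ℝ (Fin d) →L[ℝ] ℝ).integrable_comp
      (hg.integrable one_le_two)
  have hi (i : Fin d) : IntegrableOn (fun x => g x i ^ 4) Ω := by
    obtain ⟨h, hw, h2⟩ := hh i
    refine ⟨(hgi i).1.pow 4, ?_⟩
    have := hw.lintegral_pow_four_lt_top hd hΩ hc hb (hgi i) (h2.integrable one_le_two)
      (by rw [← eLpNorm_two_sq_eq_lintegral]; exact ENNReal.pow_ne_top h2.2.ne)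
    simpa [HasFiniteIntegral, enorm_pow] using this
  refine Integrable.mono' ((integrable_finsetSum Finset.univ fun i _ => hi i).const_mul (d : ℝ))
    (hg.1.norm.pow 4) (Filter.Eventually.of_forall fun x => ?_)
  -- Cauchy–Schwarz: |g|⁴ = (∑ gᵢ²)² ≤ d ∑ gᵢ⁴.
  have h1 := sq_sum_le_card_mul_sum_sq (s := Finset.univ) (f := fun i => g x i ^ 2)
  rw [Finset.card_univ, Fintype.card_fin] at h1
  rw [Real.norm_of_nonneg (by positivity), show ‖g x‖ ^ 4 = (‖g x‖ ^ 2) ^ 2 by ring,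
    EuclideanSpace.real_norm_sq_eq]
  refine h1.trans (le_of_eq ?_)
  congr 1
  exact Finset.sum_congr rfl fun i _ => by ring

/-- The integrand equals u⁻²|g|⁴, at most k⁻²|g|⁴. -/
theorem integrableOn_sq_mul_norm_log_pow_four (hk : 0 < k) (hu : IntegrableOn u Ω)
    (huk : ∀ᵐ x ∂(volume.restrict Ω), u x ∈ Set.Icc k k⁻¹) (hg : IntegrableOn g Ω)
    (hg4 : IntegrableOn (fun x => ‖g x‖ ^ 4) Ω) :
    IntegrableOn (fun x => u x ^ 2 * ‖(u x)⁻¹ • g x‖ ^ 4) Ω := by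
  refine Integrable.mono' (hg4.const_mul ((k⁻¹) ^ 2))
    ((hu.1.pow 2).mul ((hu.1.aemeasurable.inv.aestronglyMeasurable.smul hg.1).norm.pow 4)) ?_
  filter_upwards [huk] with x hx
  have h0 : 0 < u x := hk.trans_le hx.1
  rw [Real.norm_of_nonneg (by positivity), norm_smul, Real.norm_of_nonneg (by positivity), mul_pow,
    ← mul_assoc]
  gcongr
  calc u x ^ 2 * (u x)⁻¹ ^ 4 = (u x)⁻¹ ^ 2 := by field_simp
    _ ≤ _ := by gcongr; exact hx.1

theorem HasWeakGradient.log (hw : HasWeakGradient Ω u g) (hΩ : IsOpen Ω) (hu : IntegrableOn u Ω)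
    (hg : IntegrableOn g Ω) (hk : 0 < k)
    (huk : ∀ᵐ x ∂(volume.restrict Ω), u x ∈ Set.Icc k k⁻¹) :
    HasWeakGradient Ω (fun x => Real.log (u x)) (fun x => (u x)⁻¹ • g x) :=
  hw.comp hΩ hu hg huk (fun _ hy => Real.hasDerivAt_log (hk.trans_le hy.1).ne')
    (continuousOn_inv₀.mono fun _ hy => (hk.trans_le hy.1).ne') Real.measurable_log measurable_inv

theorem HasWeakGradient.sqrt (hw : HasWeakGradient Ω u g) (hΩ : IsOpen Ω) (hu : IntegrableOn u Ω)
    (hg : IntegrableOn g Ω) (hk : 0 < k)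
    (huk : ∀ᵐ x ∂(volume.restrict Ω), u x ∈ Set.Icc k k⁻¹) :
    HasWeakGradient Ω (fun x => √(u x)) (fun x => (1 / (2 * √(u x))) • g x) := by
  refine hw.comp (F := Real.sqrt) (F' := fun y => 1 / (2 * √y)) hΩ hu hg huk
    (fun y hy => Real.hasDerivAt_sqrt (hk.trans_le hy.1).ne') ?_
    Real.continuous_sqrt.measurable (by fun_prop)
  refine ContinuousOn.div (by fun_prop) (by fun_prop) fun y hy => ?_
  have := Real.sqrt_pos.2 (hk.trans_le hy.1)
  positivity

/-- The `L⁴` norm of `u` is controlled by its `L²` norm and by the `L⁴` norm of `∇√u`, with a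
free parameter. -/
theorem exists_interpolation_const (hd : d ≤ 3) (hΩ : IsOpen Ω) (hc : Convex ℝ Ω)
    (hb : Bornology.IsBounded Ω) (hne : Ω.Nonempty) :
    ∃ C : NNReal, ∀ (u : EuclideanSpace ℝ (Fin d) → ℝ)
      (g : EuclideanSpace ℝ (Fin d) → EuclideanSpace ℝ (Fin d)) (k : ℝ), 0 < k →
      HasWeakGradient Ω u g → MemLp u 2 (volume.restrict Ω) → IntegrableOn g Ω →
      (∀ᵐ x ∂(volume.restrict Ω), u x ∈ Set.Icc k k⁻¹) →
      IntegrableOn (fun x => ‖g x‖ ^ 4) Ω → ∀ t : ℝ, 0 < t → t ≤ 1 →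
      ∫ x in Ω, u x ^ 4 ≤ (∫ x in Ω, u x ^ 2) * (C * ((t ^ 3)⁻¹ * (∫ x in Ω, u x ^ 2) +
        t * ∫ x in Ω, u x ^ 2 * ‖(u x)⁻¹ • g x‖ ^ 4)) := by
  have : IsFiniteMeasure (volume.restrict Ω) :=
    ⟨by rw [Measure.restrict_apply_univ]; exact hb.measure_lt_top⟩
  obtain ⟨C, hC⟩ := exists_morrey_const hd hΩ hc hb hne
  refine ⟨C, fun u g k hk hw hu2 hg huk hg4 t ht ht1 => ?_⟩
  have hu : IntegrableOn u Ω := hu2.integrable one_le_two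
  have hws := hw.sqrt hΩ hu hg hk huk
  have hJ := integrableOn_sq_mul_norm_log_pow_four hk hu huk hg hg4
  have husq : IntegrableOn (fun x => u x ^ 2) Ω := hu2.integrable_sq
  set I := ∫ x in Ω, u x ^ 2 with hI
  set J := ∫ x in Ω, u x ^ 2 * ‖(u x)⁻¹ • g x‖ ^ 4 with hJd
  have hI0 : 0 ≤ I := integral_nonneg fun x => sq_nonneg _
  have hJ0 : 0 ≤ J := integral_nonneg fun x => by positivity
  have hsm : AEStronglyMeasurable (fun x => √(u x)) (volume.restrict Ω) :=
    (Real.continuous_sqrt.measurable.comp_aemeasurable hu.aemeasurable).aestronglyMeasurable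
  have hsi : IntegrableOn (fun x => √(u x)) Ω := by
    refine Integrable.of_bound (C := √(k⁻¹)) hsm (huk.mono fun x hx => ?_)
    rw [Real.norm_of_nonneg (Real.sqrt_nonneg _)]
    exact Real.sqrt_le_sqrt hx.2
  have hgsi : IntegrableOn (fun x => (1 / (2 * √(u x))) • g x) Ω := by
    refine Integrable.bdd_smul (φ := fun x => 1 / (2 * √(u x))) hg (1 / (2 * √k)) ?_ ?_
    · exact (measurable_const.aemeasurable.div
        (hsm.aemeasurable.const_mul 2)).aestronglyMeasurable
    · filter_upwards [huk] with x hx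
      have h0 : 0 < √k := Real.sqrt_pos.2 hk
      rw [Real.norm_of_nonneg (by positivity)]
      gcongr
      exact hx.1
  have e1 : ∫⁻ y in Ω, ‖√(u y)‖ₑ ^ 4 = ENNReal.ofReal I := by
    rw [hI, ofReal_integral_eq_lintegral_ofReal husq
      (Filter.Eventually.of_forall fun x => sq_nonneg (u x))]
    refine lintegral_congr_ae (huk.mono fun x hx => ?_)
    have h0 : 0 ≤ u x := hk.le.trans hx.1
    simp only
    rw [← enorm_pow, Real.enorm_of_nonneg (by positivity),
      show √(u x) ^ 4 = (√(u x) ^ 2) ^ 2 by ring, Real.sq_sqrt h0]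
  -- Here |∇√u|⁴ = |g|⁴/(16u²) = u²|∇log u|⁴/16; the factor 1/16 is discarded.
  have e2 : ∫⁻ y in Ω, ‖(1 / (2 * √(u y))) • g y‖ₑ ^ 4 ≤ ENNReal.ofReal J := by
    rw [hJd, ofReal_integral_eq_lintegral_ofReal hJ
      (Filter.Eventually.of_forall fun x => by positivity)]
    refine lintegral_mono_ae (huk.mono fun x hx => ?_)
    have h0 : 0 < u x := hk.trans_le hx.1
    have hs0 : 0 < √(u x) := Real.sqrt_pos.2 h0
    rw [← ofReal_norm, ← ENNReal.ofReal_pow (norm_nonneg _)]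
    refine ENNReal.ofReal_le_ofReal ?_
    rw [norm_smul, norm_smul, Real.norm_of_nonneg (by positivity),
      Real.norm_of_nonneg (by positivity), mul_pow, mul_pow, ← mul_assoc]
    gcongr
    have h4 : (2 * √(u x)) ^ 4 = 16 * u x ^ 2 := by
      rw [mul_pow, show √(u x) ^ 4 = (√(u x) ^ 2) ^ 2 by ring, Real.sq_sqrt h0.le]; norm_num
    rw [div_pow, h4]
    calc (1 : ℝ) ^ 4 / (16 * u x ^ 2) ≤ 1 / u x ^ 2 := by
          rw [one_pow]; gcongr; nlinarith [sq_nonneg (u x)]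
      _ = u x ^ 2 * (u x)⁻¹ ^ 4 := by field_simp
  -- Morrey's inequality for √u, whose fourth power is u².
  have hbound : ∀ᵐ x ∂(volume.restrict Ω), u x ^ 2 ≤ C * ((t ^ 3)⁻¹ * I + t * J) := by
    filter_upwards [hC _ _ hws hsi hgsi t ht ht1, huk] with x hx hxk
    have h0 : 0 ≤ u x := hk.le.trans hxk.1
    have h1 : ENNReal.ofReal (u x ^ 2) ≤ ENNReal.ofReal (C * ((t ^ 3)⁻¹ * I + t * J)) := by
      rw [ENNReal.ofReal_mul C.coe_nonneg, ENNReal.ofReal_add (by positivity) (by positivity),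
        ENNReal.ofReal_mul (by positivity), ENNReal.ofReal_mul ht.le, ENNReal.ofReal_coe_nnreal]
      calc ENNReal.ofReal (u x ^ 2) = ‖√(u x)‖ₑ ^ 4 := by
            rw [← enorm_pow, Real.enorm_of_nonneg (by positivity),
              show √(u x) ^ 4 = (√(u x) ^ 2) ^ 2 by ring, Real.sq_sqrt h0]
        _ ≤ _ := hx
        _ ≤ _ := by
          rw [e1]
          exact mul_le_mul_right (add_le_add_right (mul_le_mul_right e2 _) _) _
    exact (ENNReal.ofReal_le_ofReal_iff (by positivity)).1 h1
  calc ∫ x in Ω, u x ^ 4 ≤ ∫ x in Ω, u x ^ 2 * (C * ((t ^ 3)⁻¹ * I + t * J)) := by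
        refine integral_mono_of_nonneg (Filter.Eventually.of_forall fun x => by positivity)
          (husq.mul_const _) (hbound.mono fun x hx => ?_)
        calc u x ^ 4 = u x ^ 2 * u x ^ 2 := by ring
          _ ≤ _ := mul_le_mul_of_nonneg_left hx (sq_nonneg _)
    _ = _ := integral_mul_const _ _

end Interpolation

/-! ### Choice of the scale and conclusion -/

theorem proposition3p2 (d : ℕ) (hd1 : 1 ≤ d) (hd3 : d ≤ 3)
    (Ω : Set (EuclideanSpace ℝ (Fin d))) (hΩo : IsOpen Ω) (hΩc : Convex ℝ Ω)
    (hΩb : Bornology.IsBounded Ω) :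
    ∃ c : ℝ → ℝ → ℝ → ℝ, (∀ δ₁ δ₂ s : ℝ, 0 < c δ₁ δ₂ s) ∧
      ∀ u : EuclideanSpace ℝ (Fin d) → ℝ, MemH2 Ω u →
      ∀ k : ℝ, 0 < k → k < 1 →
      (∀ᵐ x ∂(volume.restrict Ω), k ≤ u x ∧ u x ≤ k⁻¹) →
      (∃ l : EuclideanSpace ℝ (Fin d) → EuclideanSpace ℝ (Fin d),
        HasWeakGradient Ω (fun x => Real.log (u x)) l) ∧
      ∀ g l : EuclideanSpace ℝ (Fin d) → EuclideanSpace ℝ (Fin d),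
        HasWeakGradient Ω u g → HasWeakGradient Ω (fun x => Real.log (u x)) l →
        IntegrableOn (fun x => u x ^ 4) Ω volume ∧
        IntegrableOn (fun x => u x ^ 2 * ‖l x‖ ^ 4) Ω volume ∧
        IntegrableOn (fun x => ‖g x‖ ^ 2) Ω volume ∧
        ∀ δ₁ δ₂ : ℝ, 0 < δ₁ → 0 < δ₂ →
          ∫ x in Ω, u x ^ 4 ≤
            δ₁ * (∫ x in Ω, u x ^ 2 * ‖l x‖ ^ 4) + δ₂ * (∫ x in Ω, ‖g x‖ ^ 2)
              + c δ₁ δ₂ (eLpNorm u 2 (volume.restrict Ω)).toReal := by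
  have hfin : IsFiniteMeasure (volume.restrict Ω) :=
    ⟨by rw [Measure.restrict_apply_univ]; exact hΩb.measure_lt_top⟩
  obtain ⟨C, hC⟩ : ∃ C : NNReal, Ω.Nonempty → ∀ (u : EuclideanSpace ℝ (Fin d) → ℝ)
      (g : EuclideanSpace ℝ (Fin d) → EuclideanSpace ℝ (Fin d)) (k : ℝ), 0 < k →
      HasWeakGradient Ω u g → MemLp u 2 (volume.restrict Ω) → IntegrableOn g Ω →
      (∀ᵐ x ∂(volume.restrict Ω), u x ∈ Set.Icc k k⁻¹) →
      IntegrableOn (fun x => ‖g x‖ ^ 4) Ω → ∀ t : ℝ, 0 < t → t ≤ 1 →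
      ∫ x in Ω, u x ^ 4 ≤ (∫ x in Ω, u x ^ 2) * (C * ((t ^ 3)⁻¹ * (∫ x in Ω, u x ^ 2) +
        t * ∫ x in Ω, u x ^ 2 * ‖(u x)⁻¹ • g x‖ ^ 4)) := by
    by_cases hne : Ω.Nonempty
    · obtain ⟨C, hC⟩ := exists_interpolation_const hd3 hΩo hΩc hΩb hne
      exact ⟨C, fun _ => hC⟩
    · exact ⟨0, fun h => absurd h hne⟩
  -- The scale t: at most 1 as Morrey requires, and such that C s² t ≤ δ₁. The summand 1 avoids
  -- division by zero. The absolute value keeps t nonnegative for every real δ, because c must be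
  -- positive at all arguments.
  set T : ℝ → ℝ → ℝ := fun δ s => min 1 (|δ| / (C * s ^ 2 + 1)) with hT
  have hT0 (δ s : ℝ) : 0 ≤ T δ s := le_min zero_le_one (by positivity)
  -- The t⁻³ term of the interpolation inequality; the summand 1 makes it strictly positive.
  refine ⟨fun δ₁ _ s => C * (s ^ 2) ^ 2 * (T δ₁ s ^ 3)⁻¹ + 1, fun δ₁ _ s => ?_, ?_⟩
  · have := hT0 δ₁ s
    positivity
  intro u hu k hk _ huk
  obtain ⟨hu2, g₀, hwg₀, hg₀2, hh⟩ := hu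
  have huk' : ∀ᵐ x ∂(volume.restrict Ω), u x ∈ Set.Icc k k⁻¹ := huk
  have hu1 : IntegrableOn u Ω := hu2.integrable one_le_two
  have hg₀1 : IntegrableOn g₀ Ω := hg₀2.integrable one_le_two
  have hg₀4 := integrableOn_norm_pow_four hd3 hΩo hΩc hΩb hg₀2 hh
  have hlog := hwg₀.log hΩo hu1 hg₀1 hk huk'
  refine ⟨⟨_, hlog⟩, fun g l hwg hwl => ?_⟩
  have hgae := hwg₀.ae_eq hΩo hwg
  have hlae := hlog.ae_eq hΩo hwl
  have hJ := integrableOn_sq_mul_norm_log_pow_four hk hu1 huk' hg₀1 hg₀4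
  have hJae : (fun x => u x ^ 2 * ‖(u x)⁻¹ • g₀ x‖ ^ 4) =ᵐ[volume.restrict Ω]
      fun x => u x ^ 2 * ‖l x‖ ^ 4 := hlae.mono fun x hx => by simp only [hx]
  refine ⟨?_, hJ.congr hJae, ?_, fun δ₁ δ₂ hδ₁ hδ₂ => ?_⟩
  · refine Integrable.of_bound (C := k⁻¹ ^ 4) (hu1.1.pow 4) (huk'.mono fun x hx => ?_)
    have h0 : 0 ≤ u x := hk.le.trans hx.1
    rw [Real.norm_of_nonneg (by positivity)]
    exact pow_le_pow_left₀ h0 hx.2 4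
  · exact hg₀2.norm.integrable_sq.congr (hgae.mono fun x hx => by simp only [hx])
  rw [← integral_congr_ae hJae]
  set J := ∫ x in Ω, u x ^ 2 * ‖(u x)⁻¹ • g₀ x‖ ^ 4 with hJd
  have hJ0 : 0 ≤ J := integral_nonneg fun x => by positivity
  have hg0 : 0 ≤ δ₂ * ∫ x in Ω, ‖g x‖ ^ 2 :=
    mul_nonneg hδ₂.le (integral_nonneg fun x => by positivity)
  set s := (eLpNorm u 2 (volume.restrict Ω)).toReal with hs
  have ht : 0 < T δ₁ s := lt_min one_pos (div_pos (abs_pos.2 hδ₁.ne') (by positivity))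
  rcases Ω.eq_empty_or_nonempty with rfl | hne
  · have : 0 ≤ δ₁ * J := mul_nonneg hδ₁.le hJ0
    have h2 : (0 : ℝ) ≤ C * (s ^ 2) ^ 2 * (T δ₁ s ^ 3)⁻¹ := by positivity
    simp only [Measure.restrict_empty, integral_zero_measure] at hg0 ⊢
    linarith
  have key := hC hne u g₀ k hk hwg₀ hu2 hg₀1 huk' hg₀4 (T δ₁ s) ht (min_le_left _ _)
  rw [← toReal_eLpNorm_two_sq hu2, ← hs, ← hJd] at key
  have hle : C * s ^ 2 * T δ₁ s ≤ δ₁ := by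
    have h1 : T δ₁ s ≤ δ₁ / (C * s ^ 2 + 1) := by
      rw [← abs_of_pos hδ₁]; simp only [hT, abs_abs]; exact min_le_right _ _
    rw [le_div_iff₀ (by positivity)] at h1
    nlinarith
  have h3 : C * s ^ 2 * T δ₁ s * J ≤ δ₁ * J := by gcongr
  calc ∫ x in Ω, u x ^ 4
      ≤ C * s ^ 2 * T δ₁ s * J + C * (s ^ 2) ^ 2 * (T δ₁ s ^ 3)⁻¹ := by
        refine key.trans (le_of_eq ?_); ring
    _ ≤ _ := by linarith
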